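/- Let $d\ge 1$, $s>0$, $\beta>0$, $h(k)=|k|^s$ on momentum space $\mathbb R^d$, and let $n(k)=(e^{\beta h(k)}-1)^{-1}$. Write $\hat f(k)=(2\pi)^{-d/2}\int e^{-ik\cdot x}f(x)\,dx$. Assume that Bose–Einstein condensation occurs at density $\bar\rho$: $\rho_c(\beta)=(2\pi)^{-d}\int n(k)\,dk<\bar\rho$. Put $\rho_0=\bar\rho-\rho_c(\beta)$ and $c=2(2\pi)^d\rho_0$. Let $\mathcal D_0$ be the space of $f\in L^1(\mathbb R^d)\cap L^2(\mathbb R^d)$ with $\int\coth(\beta h(k)/2)\,|\hat f(k)|^2\,dk<\infty$. Let $\mathcal F$ be the bosonic Fock space over $L^2(\mathbb R^d)\oplus\overline{L^2(\mathbb R^d)}$ with Segal fields $\Phi(g)=\overline{2^{-1/2}(a^*(g)+a(g))}$. For $f\in\mathcal D_0$ let $\Phi_{\beta,l}(f)=\Phi\big((1+n)^{1/2}\hat f\oplus\overline{n^{1/2}\hat f}\big)$ be the left Araki–Woods field and $R_{\beta,l}(z,f)=(iz-\Phi_{\beta,l}(f))^{-1}$, $\operatorname{Re}z\neq0$, its resolvent.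 For $(r,\theta)\in\mathbb R^2$ (with $\sqrt{x}:=0$ if $x<0$) put $$\ell_{r,\theta}(f)=\sqrt{c\,r}\,\operatorname{Re}\big(e^{i\theta}\hat f(0)\big),\qquad \pi_{r,\theta}(R(\lambda,f))=R_{\beta,l}(\lambda-i\ell_{r,\theta}(f),f)\quad(\lambda\in\mathbb R\setminus\{0\}).$$ Let $d\chi(r,\theta)=e^{-r}dr\otimes\frac{d\theta}{2\pi}$ on $(0,\infty)\times[0,2\pi)$. The BEC representation is the direct integral $\pi_{\mathrm{BEC}}(R(\lambda,f))=\int^{\oplus}\pi_{r,\theta}(R(\lambda,f))\,d\chi(r,\theta)$ on $L^2(\chi;\mathcal F)$, and $\mathcal M_{\mathrm{BEC}}$ is the closure, in the strong operator topology, of the C*-algebra generated by all $\pi_{\mathrm{BEC}}(R(\lambda,f))$ with $f\in\mathcal D_0$, $\lambda\in\mathbb R\setminus\{0\}$. For $L>0$ let $b_L^{(1)}=L^{-d}\mathbf 1_{[-L/2,L/2]^d}$, and put $$a=(2\pi)^{-d/2}\sqrt{c}=\sqrt{2\rho_0},\qquad z(r,\theta)=1-i\,a\sqrt r\cos\theta,\qquad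 F(r,\theta)=\frac1{i\,z(r,\theta)}.$$ Proposition. All these resolvents and direct integrals exist. For every $L>0$ one has $b_L^{(1)}\in\mathcal D_0$, $\ell_{r,\theta}(b_L^{(1)})=a\sqrt r\cos\theta$, and therefore $\pi_{r,\theta}(R(1,b_L^{(1)}))=R_{\beta,l}(z(r,\theta),b_L^{(1)})$. On each fibre, as $L\to\infty$, $R_{\beta,l}(z(r,\theta),b_L^{(1)})$ converges in the strong operator topology to $R_{\beta,l}(z(r,\theta),0)=F(r,\theta)\mathbf 1$. The function $F$ is continuous with $|F|\le1$. The operators $\pi_{\mathrm{BEC}}(R(1,b_L^{(1)}))$ converge in the strong operator topology, as $L\to\infty$, to the operator of multiplication by $F$ on $L^2(\chi;\mathcal F)$, and this operator belongs to the center of the von Neumann algebra $\mathcal M_{\mathrm{BEC}}$. -/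

import Mathlib

open MeasureTheory Filter Topology
open scoped ENNReal

noncomputable section

namespace BoseGas

/-! ### Bosonic Fock space over `L²(X, μ)` -/

section Fock

variable {X : Type*} [MeasurableSpace X] (μ : Measure X) [SigmaFinite μ]

theorem measurePreserving_comp_perm (n : ℕ) (σ : Equiv.Perm (Fin n)) :
    MeasurePreserving (fun x : Fin n → X => x ∘ σ)
      (Measure.pi fun _ => μ) (Measure.pi fun _ => μ) := by
  have h := measurePreserving_piCongrLeft (α := fun _ : Fin n => X) (fun _ => μ) σ.symm
  have e : (fun x : Fin n → X => x ∘ σ)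
      = (MeasurableEquiv.piCongrLeft (fun _ : Fin n => X) σ.symm) := by
    funext x i
    have := MeasurableEquiv.piCongrLeft_apply_apply (e := σ.symm) (β := fun _ => X) x (σ i)
    simpa using this.symm
  rw [e]
  exact h

/-- Square integrable functions of `n` variables (the `n`-fold Hilbert tensor power of `L²(X, μ)`). -/
abbrev NParticle (n : ℕ) : Type _ := Lp ℂ 2 (Measure.pi fun _ : Fin n => μ)

/-- The permutation symmetric square integrable functions of `n` variables
(the `n`-fold symmetric Hilbert tensor power of `L²(X, μ)`). -/
def symmetricSubspace (n : ℕ) : Submodule ℂ (NParticle μ n) where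
  carrier := {ψ | ∀ σ : Equiv.Perm (Fin n),
    Lp.compMeasurePreserving (fun x : Fin n → X => x ∘ σ)
      (measurePreserving_comp_perm μ n σ) ψ = ψ}
  add_mem' := by
    intro a b ha hb σ
    rw [map_add, ha σ, hb σ]
  zero_mem' := by
    intro σ
    rw [map_zero]
  smul_mem' := by
    intro c a ha σ
    have h := (Lp.compMeasurePreservingₗ (p := 2) ℂ (fun x : Fin n → X => x ∘ σ)
      (measurePreserving_comp_perm μ n σ)).map_smul c a
    exact h.trans (congrArg (fun y => c • y) (ha σ))

/-- The bosonic Fock space over `L²(X, μ)`: the Hilbert direct sum of its symmetric powers. -/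
abbrev Fock : Type _ := lp (fun n : ℕ => symmetricSubspace μ n) 2

variable {μ}

/-- The `n`-particle wave function of a Fock space vector. -/
def Fock.component (ψ : Fock μ) (n : ℕ) : (Fin n → X) → ℂ :=
  ((ψ n : symmetricSubspace μ n) : NParticle μ n)

/-- The vectors with finitely many non-zero components. -/
def IsFiniteParticle (ψ : Fock μ) : Prop := ∃ N : ℕ, ∀ n : ℕ, N ≤ n → ψ n = 0

/-- The creation operator `a*(g)` from `n`-particle to `(n+1)`-particle wave functions,
`(a*(g) φ)(x₀, …, xₙ) = (n+1)^{-1/2} ∑ⱼ g(xⱼ) φ(x₀, …, x̂ⱼ, …, xₙ)`. -/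
def creation (g : X → ℂ) {n : ℕ} (φ : (Fin n → X) → ℂ) (x : Fin (n + 1) → X) : ℂ :=
  ((Real.sqrt (n + 1) : ℝ) : ℂ)⁻¹ * ∑ j : Fin (n + 1), g (x j) * φ (fun i => x (j.succAbove i))

variable (μ) in
/-- The annihilation operator `a(g)` from `(n+1)`-particle to `n`-particle wave functions,
`(a(g) φ)(x₁, …, xₙ) = (n+1)^{1/2} ∫ conj (g y) φ(y, x₁, …, xₙ) dμ(y)`. -/
def annihilation (g : X → ℂ) {n : ℕ} (φ : (Fin (n + 1) → X) → ℂ) (x : Fin n → X) : ℂ :=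
  ((Real.sqrt (n + 1) : ℝ) : ℂ) * ∫ y, (starRingEnd ℂ) (g y) * φ (Fin.cons y x) ∂μ

/-- The `n`-particle wave function of `2^{-1/2} (a*(g) + a(g)) ψ`. -/
def segalComponent (g : X → ℂ) (ψ : Fock μ) : (n : ℕ) → (Fin n → X) → ℂ
  | 0 => fun x => ((Real.sqrt 2 : ℝ) : ℂ)⁻¹ * annihilation μ g (ψ.component 1) x
  | n + 1 => fun x => ((Real.sqrt 2 : ℝ) : ℂ)⁻¹ *
      (creation g (ψ.component n) x + annihilation μ g (ψ.component (n + 2)) x)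

/-- The graph of the Segal field operator `2^{-1/2} (a*(g) + a(g))` on finite particle vectors. -/
def segalGraph (g : X → ℂ) : Set (Fock μ × Fock μ) :=
  {p | IsFiniteParticle p.1 ∧
    ∀ n, p.2.component n =ᵐ[Measure.pi fun _ : Fin n => μ] segalComponent g p.1 n}

variable (μ) in
/-- The graph of the closure `Φ(g)` of the Segal field operator (a self-adjoint operator
for `g ∈ L²(X, μ)`). -/
def segalField (g : X → ℂ) : Set (Fock μ × Fock μ) := closure (segalGraph g)

end Fock

/-! ### Resolvents of unbounded operators, given by their graphs -/

section Resolvent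

variable {H : Type*} [NormedAddCommGroup H] [NormedSpace ℂ H]

/-- `R = (w - A)⁻¹`, as an everywhere defined bounded operator, where `A` is the operator with
graph `G`: `R` maps into the domain, `(w - A) R x = x`, and `R (w - A) x = x` on the domain. -/
def IsResolvent (G : Set (H × H)) (w : ℂ) (R : H →L[ℂ] H) : Prop :=
  (∀ x, (R x, w • R x - x) ∈ G) ∧ ∀ p ∈ G, R (w • p.1 - p.2) = p.1

open Classical in
/-- The (unique) resolvent `(w - A)⁻¹` of the operator `A` with graph `G`; it is `0` if `w` is not
in the resolvent set. -/
def resolventOp (G : Set (H × H)) (w : ℂ) : H →L[ℂ] H :=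
  if h : ∃ R, IsResolvent G w R then h.choose else 0

end Resolvent

/-! ### The free Bose gas -/

/-- Position space (and momentum space). -/
abbrev Space (d : ℕ) : Type := EuclideanSpace ℝ (Fin d)

/-- The unitarily normalised Fourier transform of an integrable function. -/
def fourier {d : ℕ} (f : Space d → ℂ) (k : Space d) : ℂ :=
  (((2 * Real.pi) ^ (-(d : ℝ) / 2) : ℝ) : ℂ) *
    ∫ x, Complex.exp (-Complex.I * ((inner ℝ k x : ℝ) : ℂ)) * f x

/-- The one-particle Hamiltonian `h(k) = |k|^s` in momentum space. -/
def oneParticleEnergy {d : ℕ} (s : ℝ) (k : Space d) : ℝ := ‖k‖ ^ s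

/-- The Planck density `1 / (e^{β h(k)} - 1)` at chemical potential `0`. -/
def planck {d : ℕ} (s β : ℝ) (k : Space d) : ℝ :=
  1 / (Real.exp (β * oneParticleEnergy s k) - 1)

/-- `K_β = coth (β h(k) / 2)`. -/
def thermalWeight {d : ℕ} (s β : ℝ) (k : Space d) : ℝ :=
  Real.cosh (β * oneParticleEnergy s k / 2) / Real.sinh (β * oneParticleEnergy s k / 2)

/-- The quadratic form `q_{≠0}(f) = ‖K_β^{1/2} f̂‖²`, with values in `[0, ∞]`. -/
def qNonzero {d : ℕ} (s β : ℝ) (f : Space d → ℂ) : ℝ≥0∞ :=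
  ∫⁻ k, ENNReal.ofReal (thermalWeight s β k * ‖fourier f k‖ ^ 2)

/-- The test function space `𝒟₀ = L¹ ∩ L² ∩ dom q_{≠0}`. -/
def testSpace (d : ℕ) (s β : ℝ) : Set (Space d → ℂ) :=
  {f | Integrable f ∧ MemLp f 2 ∧ qNonzero s β f < ∞}

/-- The critical density `(2π)^{-d} ∫ 1 / (e^{β h(k)} - 1) dk`, with values in `[0, ∞]`. -/
def criticalDensity (d : ℕ) (s β : ℝ) : ℝ≥0∞ :=
  ENNReal.ofReal ((2 * Real.pi) ^ (-(d : ℝ))) *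
    ∫⁻ k : Space d, ENNReal.ofReal (planck s β k)

/-- The condensate density `ρ₀(β) = ρ̄ - ρ_c(β)` (for `ρ_c(β) < ρ̄`). -/
def condensateDensity (d : ℕ) (s β ρbar : ℝ) : ℝ := ρbar - (criticalDensity d s β).toReal

/-- The constant `c(ρ̄, β) = 2 (2π)^d ρ₀(β)`. -/
def condensateConst (d : ℕ) (s β ρbar : ℝ) : ℝ :=
  2 * (2 * Real.pi) ^ (d : ℝ) * condensateDensity d s β ρbar

/-- `ℓ_{β,r,θ}(f) = √(c(ρ̄, β) r) Re (e^{iθ} f̂(0))`, for `p = (r, θ)`. -/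
def classicalField {d : ℕ} (s β ρbar : ℝ) (p : ℝ × ℝ) (f : Space d → ℂ) : ℝ :=
  Real.sqrt (condensateConst d s β ρbar * p.1) *
    (Complex.exp (Complex.I * (p.2 : ℂ)) * fourier f 0).re

/-- The cube `[-L/2, L/2]^d`. -/
def cube (d : ℕ) (L : ℝ) : Set (Space d) := {x | ∀ i, x i ∈ Set.Icc (-(L / 2)) (L / 2)}

/-- `b_L^{(1)} = L^{-d} 1_{[-L/2, L/2]^d}`. -/
def zeroModeTest (d : ℕ) (L : ℝ) : Space d → ℂ :=
  (cube d L).indicator fun _ => ((L ^ d : ℝ) : ℂ)⁻¹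

/-! ### The left Araki–Woods representation -/

/-- The measure space of two copies of momentum space; its `L²` space is
`L²(ℝ^d) ⊕ L²(ℝ^d)`, the second summand standing for the conjugate Hilbert space. -/
abbrev doubledMeasure (d : ℕ) : Measure (Fin 2 × Space d) :=
  (Measure.count : Measure (Fin 2)).prod volume

/-- The Araki–Woods Hilbert space, the Fock space over `L²(ℝ^d) ⊕ L²(ℝ^d)`. -/
abbrev ArakiWoods (d : ℕ) : Type := Fock (doubledMeasure d)

/-- The one-particle vector `((1 + ρ)^{1/2} f̂) ⊕ conj (ρ^{1/2} f̂)`, with `ρ` the Planck density. -/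
def arakiWoodsVector {d : ℕ} (s β : ℝ) (f : Space d → ℂ) (x : Fin 2 × Space d) : ℂ :=
  if x.1 = 0 then ((Real.sqrt (1 + planck s β x.2) : ℝ) : ℂ) * fourier f x.2
  else ((Real.sqrt (planck s β x.2) : ℝ) : ℂ) * (starRingEnd ℂ) (fourier f x.2)

/-- The left Araki–Woods field operator `Φ_{β,l}(f)` (its graph). -/
def arakiWoodsField {d : ℕ} (s β : ℝ) (f : Space d → ℂ) : Set (ArakiWoods d × ArakiWoods d) :=
  segalField (doubledMeasure d) (arakiWoodsVector s β f)

/-- The left Araki–Woods resolvent `R_{β,l}(z, f) = (i z - Φ_{β,l}(f))⁻¹`, `Re z ≠ 0`. -/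
def arakiWoodsResolvent {d : ℕ} (s β : ℝ) (z : ℂ) (f : Space d → ℂ) :
    ArakiWoods d →L[ℂ] ArakiWoods d :=
  resolventOp (arakiWoodsField s β f) (Complex.I * z)

/-! ### The BEC representation -/

/-- The probability measure `dχ(r, θ) = e^{-r} dr ⊗ dθ / 2π` on `(0, ∞) × [0, 2π)`. -/
def chi : Measure (ℝ × ℝ) :=
  ((volume.restrict (Set.Ioi 0)).withDensity fun r : ℝ => ENNReal.ofReal (Real.exp (-r))).prod
    (ENNReal.ofReal (1 / (2 * Real.pi)) • volume.restrict (Set.Ico 0 (2 * Real.pi)))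

/-- The constant fibre direct integral `∫^⊕ 𝓕 dχ(r, θ) = L²(χ; 𝓕)` of Araki–Woods spaces. -/
abbrev BECSpace (d : ℕ) : Type := Lp (ArakiWoods d) 2 chi

/-- `S = ∫^⊕ T_{r,θ} dχ(r, θ)`. -/
def IsDirectIntegral {d : ℕ} (T : ℝ × ℝ → (ArakiWoods d →L[ℂ] ArakiWoods d))
    (S : BECSpace d →L[ℂ] BECSpace d) : Prop :=
  ∀ Ψ : BECSpace d, S Ψ =ᵐ[chi] fun p => T p (Ψ p)

open Classical in
/-- The direct integral `∫^⊕ T_{r,θ} dχ(r, θ)` of a family of operators (`0` if it does not exist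
as a bounded operator). -/
def directIntegral {d : ℕ} (T : ℝ × ℝ → (ArakiWoods d →L[ℂ] ArakiWoods d)) :
    BECSpace d →L[ℂ] BECSpace d :=
  if h : ∃ S, IsDirectIntegral T S then h.choose else 0

/-- The fibre representation on generators,
`π_{r,θ}(R(lam, f)) = R_{β,l}(lam - i ℓ_{β,r,θ}(f), f)`. -/
def fibreRep {d : ℕ} (s β ρbar : ℝ) (lam : ℝ) (f : Space d → ℂ) (p : ℝ × ℝ) :
    ArakiWoods d →L[ℂ] ArakiWoods d :=
  arakiWoodsResolvent s β ((lam : ℂ) - Complex.I * (classicalField s β ρbar p f : ℂ)) f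

/-- The BEC representation on generators, `π_BEC(R(lam, f)) = ∫^⊕ π_{r,θ}(R(lam, f)) dχ(r, θ)`. -/
def becRep {d : ℕ} (s β ρbar : ℝ) (lam : ℝ) (f : Space d → ℂ) :
    BECSpace d →L[ℂ] BECSpace d :=
  directIntegral (fibreRep s β ρbar lam f)

/-- The image of the resolvent algebra over `𝒟₀` under the BEC representation: the norm closed
algebra generated by the `π_BEC(R(lam, f))`. It is a C*-algebra, since the set of generators is
closed under adjoints: `R(lam, f)* = R(-lam, f)`. -/
def becCStarAlgebra (d : ℕ) (s β ρbar : ℝ) : Set (BECSpace d →L[ℂ] BECSpace d) :=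
  closure (Algebra.adjoin ℂ
    {T | ∃ lam : ℝ, lam ≠ 0 ∧ ∃ f ∈ testSpace d s β, T = becRep s β ρbar lam f} :
      Set (BECSpace d →L[ℂ] BECSpace d))

/-- The von Neumann algebra `𝓜_BEC`: the closure of `π_BEC` of the resolvent algebra in the strong
operator topology, that is, in the topology of pointwise convergence. -/
def becVonNeumann (d : ℕ) (s β ρbar : ℝ) : Set (BECSpace d →L[ℂ] BECSpace d) :=
  {T | (⇑T : BECSpace d → BECSpace d) ∈
    closure ((fun A : BECSpace d →L[ℂ] BECSpace d => (⇑A : BECSpace d → BECSpace d)) ''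
      becCStarAlgebra d s β ρbar)}

/-- The center of `𝓜_BEC`. -/
def becCenter (d : ℕ) (s β ρbar : ℝ) : Set (BECSpace d →L[ℂ] BECSpace d) :=
  {T | T ∈ becVonNeumann d s β ρbar ∧ ∀ S ∈ becVonNeumann d s β ρbar, T * S = S * T}

/-! ### The order parameter -/

/-- The constant `a = (2π)^{-d/2} √c(ρ̄, β)`. -/
def orderConst (d : ℕ) (s β ρbar : ℝ) : ℝ :=
  (2 * Real.pi) ^ (-(d : ℝ) / 2) * Real.sqrt (condensateConst d s β ρbar)

/-- `z(r, θ) = 1 - i a √r cos θ`. -/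
def fibrePoint (d : ℕ) (s β ρbar : ℝ) (p : ℝ × ℝ) : ℂ :=
  1 - Complex.I * ((orderConst d s β ρbar * Real.sqrt p.1 * Real.cos p.2 : ℝ) : ℂ)

/-- `F(r, θ) = 1 / (i z(r, θ))`. -/
def orderFunction (d : ℕ) (s β ρbar : ℝ) (p : ℝ × ℝ) : ℂ :=
  1 / (Complex.I * fibrePoint d s β ρbar p)

end BoseGas

end

noncomputable section

namespace BoseGas

/-! ### Resolvents of closed symmetric operators -/

section Resolvent

variable {H : Type*} [NormedAddCommGroup H] [NormedSpace ℂ H] {G : Set (H × H)} {w w' : ℂ}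
  {R R' : H →L[ℂ] H}

/-! The averages $b_L$ lose their quantum part as $L\to\infty$ but keep their classical part. Since
$\int b_L=1$, the value $\hat b_L(0)=(2\pi)^{-d/2}$ does not depend on $L$, so neither does the
shift $\ell_{r,\theta}(b_L)$. For $k\ne0$, on the other hand, $\hat b_L(k)\to0$, and the
one-particle vector of the Araki–Woods field satisfies $\|g_L\|^2=\int\coth(\beta h/2)|\hat
b_L|^2=\int(1+2n)|\hat b_L|^2$. The finite critical density makes $n$ integrable, and dominated
convergence gives $\|g_L\|\to0$ (`tendsto_qNonzero_zeroModeTest`).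

For $w=iz$ and a finite particle vector $\psi$, $R\psi-w^{-1}\psi=w^{-1}R\,\Phi(g_L)\psi$, which is
$O(\|g_L\|)$ because $\|R\|\le|\operatorname{Im}w|^{-1}$. Density of these vectors gives strong
convergence to $1/(iz)=F$ on each fibre (`tendsto_resolvent_jacobi`).

The resolvents exist because $\Phi(g)$ is essentially self-adjoint on finite particle vectors:
graded by particle number it is a block Jacobi operator with blocks $O(\sqrt{n+1})$, and a
Carleman-type argument excludes deficiency vectors (`eq_zero_of_forall_inner_jacobiGraph`). Their
direct integrals exist because the resolvent is norm continuous in $w$ and bounded uniformly in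
$(r,\theta)$.

Dominated convergence over $\chi$ lifts the fibrewise limit to $L^2(\chi;\mathcal F)$
(`tendsto_directIntegral`). The limit lies in the strong closure by construction. Being diagonal it
commutes with every decomposable generator, hence with all of $\mathcal M_{\mathrm{BEC}}$
(`commute_becVonNeumann`). -/

theorem IsResolvent.eq (h : IsResolvent G w R) (h' : IsResolvent G w R') : R = R' := by
  ext x
  simpa using h.2 _ (h'.1 x)

theorem IsResolvent.isResolvent_resolventOp (h : IsResolvent G w R) :
    IsResolvent G w (resolventOp G w) := by
  have hex : ∃ R, IsResolvent G w R := ⟨R, h⟩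
  rw [resolventOp, dif_pos hex]
  exact hex.choose_spec

theorem IsResolvent.resolventOp_eq (h : IsResolvent G w R) : resolventOp G w = R :=
  h.isResolvent_resolventOp.eq h

/-- The first resolvent identity, from which norm continuity in the spectral parameter follows. -/
theorem IsResolvent.sub_eq (h : IsResolvent G w R) (h' : IsResolvent G w' R') :
    R - R' = (w' - w) • (R * R') := by
  ext x
  have h1 := h.2 _ (h'.1 x)
  have h2 : w • R' x - (w' • R' x - x) = (w - w') • R' x + x := by rw [sub_smul]; abel
  simp only [h2, map_add, map_smul] at h1
  change R x - R' x = (w' - w) • R (R' x)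
  rw [← sub_eq_zero] at h1 ⊢
  exact Eq.trans (by module) h1

end Resolvent

section Symmetric

variable {H : Type*} [NormedAddCommGroup H] [InnerProductSpace ℂ H]

/-- Here `y` plays the role of $Ax$ with $A$ symmetric: $\langle x,y\rangle$ is real, so
$\operatorname{Im}\langle x,wx-y\rangle=\operatorname{Im}w\,\|x\|^2$, and Cauchy–Schwarz applies. -/
theorem abs_im_mul_norm_le {x y : H} (hxy : inner ℂ y x = inner ℂ x y) (w : ℂ) :
    |w.im| * ‖x‖ ≤ ‖w • x - y‖ := by
  rcases eq_or_ne x 0 with rfl | hx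
  · simp
  have him : (inner ℂ x y : ℂ).im = 0 := by
    have := inner_conj_symm (𝕜 := ℂ) x y
    rw [hxy] at this
    exact Complex.conj_eq_iff_im.mp this
  have h1 : (inner ℂ x (w • x - y) : ℂ).im = w.im * ‖x‖ ^ 2 := by
    rw [inner_sub_right, inner_smul_right, inner_self_eq_norm_sq_to_K, Complex.sub_im, him]
    simp [← Complex.ofReal_pow]
  have h2 : |w.im| * ‖x‖ ^ 2 ≤ ‖x‖ * ‖w • x - y‖ := by
    calc |w.im| * ‖x‖ ^ 2 = |(inner ℂ x (w • x - y) : ℂ).im| := by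
          rw [h1, abs_mul, abs_of_nonneg (sq_nonneg ‖x‖)]
      _ ≤ ‖(inner ℂ x (w • x - y) : ℂ)‖ := Complex.abs_im_le_norm _
      _ ≤ _ := norm_inner_le_norm _ _
  have hx' : 0 < ‖x‖ := norm_pos_iff.mpr hx
  refine le_of_mul_le_mul_left ?_ hx'
  nlinarith

/-- A symmetric operator whose range after subtraction of a non-real `w` is dense
has a closure with `w` in the resolvent set. -/
theorem exists_isResolvent_closure [CompleteSpace H] (G : Submodule ℂ (H × H))
    (hG : ∀ p ∈ G, (inner ℂ p.2 p.1 : ℂ) = inner ℂ p.1 p.2) {w : ℂ} (hw : w.im ≠ 0)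
    (hd : ∀ η : H, (∀ p ∈ G, (inner ℂ (w • p.1 - p.2) η : ℂ) = 0) → η = 0) :
    ∃ R, IsResolvent (closure (G : Set (H × H))) w R ∧ ‖R‖ ≤ |w.im|⁻¹ := by
  have hw' : 0 < |w.im| := abs_pos.mpr hw
  have hlow : ∀ p ∈ closure (G : Set (H × H)), |w.im| * ‖p.1‖ ≤ ‖w • p.1 - p.2‖ := by
    have hcl : IsClosed {p : H × H | |w.im| * ‖p.1‖ ≤ ‖w • p.1 - p.2‖} :=
      isClosed_le (by fun_prop) (by fun_prop)
    exact fun p hp => closure_minimal (fun q hq => abs_im_mul_norm_le (hG q hq) w) hcl hp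
  -- The closed graph is itself a Hilbert space, on which $w-A$ becomes a bounded operator `T`. It
  -- remains to see that `T` is bounded below with dense range.
  let K := G.topologicalClosure
  have hKc : CompleteSpace K := G.isClosed_topologicalClosure.completeSpace_coe
  let T : K →L[ℂ] H :=
    (w • ContinuousLinearMap.fst ℂ H H - ContinuousLinearMap.snd ℂ H H) ∘L K.subtypeL
  have hT : ∀ p : K, T p = w • p.1.1 - p.1.2 := fun p => rfl
  have hmem : ∀ p : K, p.1 ∈ closure (G : Set (H × H)) := fun p => p.2
  have h1 : ∀ p : K, ‖p.1.1‖ ≤ |w.im|⁻¹ * ‖T p‖ := fun p => by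
    rw [inv_mul_eq_div, le_div_iff₀ hw', mul_comm, hT]
    exact hlow _ (hmem p)
  have hanti : ∃ C, AntilipschitzWith C T := by
    -- The first term bounds $\|x\|$ and the bracket bounds $\|Ax\|\le\|w\|\|x\|+\|T(x,Ax)\|$.
    refine ⟨⟨|w.im|⁻¹ + (‖w‖ * |w.im|⁻¹ + 1), by positivity⟩,
      AddMonoidHomClass.antilipschitz_of_bound T fun p => ?_⟩
    have h2 : ‖p.1.2‖ ≤ ‖w‖ * ‖p.1.1‖ + ‖T p‖ := by
      have : p.1.2 = w • p.1.1 - T p := by rw [hT]; abel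
      rw [this]
      exact (norm_sub_le _ _).trans (by rw [norm_smul])
    have h3 : ‖p‖ ≤ ‖p.1.1‖ + ‖p.1.2‖ := by
      change max ‖p.1.1‖ ‖p.1.2‖ ≤ _
      exact max_le (by linarith [norm_nonneg p.1.2]) (by linarith [norm_nonneg p.1.1])
    have h4 := mul_le_mul_of_nonneg_left (h1 p) (norm_nonneg w)
    change ‖p‖ ≤ (|w.im|⁻¹ + (‖w‖ * |w.im|⁻¹ + 1)) * ‖T p‖
    linarith [h1 p]
  obtain ⟨C, hC⟩ := hanti
  have hinj : Function.Injective T := hC.injective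
  have hclosed : IsClosed (Set.range T) := hC.isClosed_range T.uniformContinuous
  have hsurj : Function.Surjective T := by
    have hr : IsClosed ((LinearMap.range (T : K →ₗ[ℂ] H) : Submodule ℂ H) : Set H) := by
      rw [LinearMap.coe_range]
      exact hclosed
    have hbot : (LinearMap.range (T : K →ₗ[ℂ] H))ᗮ = ⊥ := by
      rw [Submodule.eq_bot_iff]
      intro η hη
      refine hd η fun p hp => ?_
      exact (Submodule.mem_orthogonal _ _).mp hη _ ⟨⟨p, subset_closure hp⟩, rfl⟩
    have htop := (Submodule.topologicalClosure_eq_top_iff).mpr hbot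
    rw [hr.submodule_topologicalClosure_eq] at htop
    exact LinearMap.range_eq_top.mp htop
  let e : K ≃L[ℂ] H := ContinuousLinearEquiv.ofBijective T
    (LinearMap.ker_eq_bot.mpr hinj) (LinearMap.range_eq_top.mpr hsurj)
  have heT : ∀ p, e p = T p := fun p => rfl
  have hTe : ∀ x, T (e.symm x) = x := fun x => e.apply_symm_apply x
  let R : H →L[ℂ] H := ContinuousLinearMap.fst ℂ H H ∘L K.subtypeL ∘L (e.symm : H →L[ℂ] K)
  have hR : ∀ x, R x = (e.symm x).1.1 := fun x => rfl
  refine ⟨R, ⟨fun x => ?_, fun p hp => ?_⟩, ?_⟩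
  · have : w • R x - x = (e.symm x).1.2 := by
      have h2 := hT (e.symm x)
      rw [hTe] at h2
      rw [hR, sub_eq_iff_eq_add, add_comm, ← sub_eq_iff_eq_add]
      exact h2.symm
    rw [this, hR]
    exact hmem _
  · have : e.symm (w • p.1 - p.2) = ⟨p, hp⟩ := by
      rw [ContinuousLinearEquiv.symm_apply_eq]
      rfl
    rw [hR, this]
  · refine ContinuousLinearMap.opNorm_le_bound _ (by positivity) fun x => ?_
    rw [hR]
    simpa [hTe] using h1 (e.symm x)

end Symmetric

/-! ### Block Jacobi operators -/

section Jacobi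

theorem sum_single_eq {E : ℕ → Type*} [∀ n, NormedAddCommGroup (E n)] {φ : lp E 2} {N : ℕ}
    (hN : ∀ n, N ≤ n → φ n = 0) :
    ∑ n ∈ Finset.range N, lp.single 2 n (φ n) = φ := by
  have h := lp.hasSum_single (p := 2) (by norm_num) φ
  refine (hasSum_sum_of_ne_finset_zero (s := Finset.range N) fun n hn => ?_).unique h
  rw [hN n (by simpa using hn), lp.single_zero]

variable {E : ℕ → Type*} [∀ n, NormedAddCommGroup (E n)] [∀ n, InnerProductSpace ℂ (E n)]
  [∀ n, CompleteSpace (E n)]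

/-- The components of `(c + c†) ψ`, where `c` raises the degree by one. -/
def jacobiComponent (c : ∀ n, E n →L[ℂ] E (n + 1)) (ψ : ∀ n, E n) : ∀ n, E n
  | 0 => (c 0).adjoint (ψ 1)
  | n + 1 => c n (ψ n) + (c (n + 1)).adjoint (ψ (n + 2))

/-- The graph of `c + c†` on the vectors with finitely many non-zero components. -/
def jacobiGraph (c : ∀ n, E n →L[ℂ] E (n + 1)) : Submodule ℂ (lp E 2 × lp E 2) where
  carrier := {p | (∃ N : ℕ, ∀ n, N ≤ n → p.1 n = 0) ∧ ∀ n, p.2 n = jacobiComponent c p.1 n}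
  add_mem' := by
    rintro p q ⟨⟨N, hN⟩, hp⟩ ⟨⟨M, hM⟩, hq⟩
    refine ⟨⟨max N M, fun n hn => ?_⟩, fun n => ?_⟩
    · simp [hN n (le_of_max_le_left hn), hM n (le_of_max_le_right hn)]
    · cases n <;> simp [hp, hq, jacobiComponent]; abel
  zero_mem' := ⟨⟨0, fun n _ => rfl⟩, fun n => by cases n <;> simp [jacobiComponent]⟩
  smul_mem' := by
    rintro z p ⟨⟨N, hN⟩, hp⟩
    refine ⟨⟨N, fun n hn => ?_⟩, fun n => ?_⟩
    · simp [hN n hn]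
    · cases n <;> simp [hp, jacobiComponent]

variable {c : ∀ n, E n →L[ℂ] E (n + 1)}

variable (c) in
/-- `(c + c†)` applied to a vector with a single non-zero component. -/
def jacobiSingle : (n : ℕ) → E n → lp E 2
  | 0, v => lp.single 2 1 (c 0 v)
  | n + 1, v => lp.single 2 (n + 2) (c (n + 1) v) + lp.single 2 n ((c n).adjoint v)

theorem single_jacobiSingle_mem (n : ℕ) (v : E n) :
    (lp.single 2 n v, jacobiSingle c n v) ∈ jacobiGraph c := by
  refine ⟨⟨n + 1, fun m hm => ?_⟩, fun m => ?_⟩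
  · exact lp.single_apply_ne _ _ _ (by omega)
  · have key : ∀ (k m : ℕ) (u : E k), (lp.single 2 k u : lp E 2) m = Pi.single k u m :=
      fun k m u => by simp
    rcases n with _ | n <;> rcases m with _ | m
    · simp [jacobiSingle, jacobiComponent]
    · rcases m with _ | m <;> simp [jacobiSingle, jacobiComponent]
    · rcases n with _ | n <;> simp [jacobiSingle, jacobiComponent]
    · simp only [jacobiSingle, jacobiComponent, lp.coeFn_add, Pi.add_apply, key]
      congr 1
      · rcases eq_or_ne m (n + 1) with rfl | h
        · simp
        · rw [Pi.single_eq_of_ne (by omega), Pi.single_eq_of_ne (by omega), map_zero]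
      · rcases eq_or_ne n (m + 1) with rfl | h
        · simp
        · rw [Pi.single_eq_of_ne (by omega), Pi.single_eq_of_ne (by omega), map_zero]

/-- Both blocks acting on degree `n` have norm at most $K\sqrt{n+1}$. Linearity in `K` at fixed `n`
and `v` is what later forces convergence as $K\to0$. -/
theorem norm_jacobiSingle_le {K : ℝ} (hc : ∀ n, ‖c n‖ ≤ K * √(n + 1)) (n : ℕ) (v : E n) :
    ‖jacobiSingle c n v‖ ≤ K * (2 * √(n + 1) * ‖v‖) := by
  have hK : 0 ≤ K := by simpa using (norm_nonneg _).trans (hc 0)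
  have h1 : ‖c n v‖ ≤ K * √(n + 1) * ‖v‖ := (c n).le_of_opNorm_le (hc n) v
  rcases n with _ | n
  · have : 0 ≤ K * √((0 : ℕ) + 1) * ‖v‖ := by positivity
    rw [jacobiSingle, lp.norm_single (by norm_num)]
    linarith
  · have h2 : ‖(c n).adjoint v‖ ≤ K * √((n + 1 : ℕ) + 1) * ‖v‖ := by
      refine ((c n).adjoint.le_of_opNorm_le ?_ v)
      rw [LinearIsometryEquiv.norm_map]
      refine (hc n).trans (mul_le_mul_of_nonneg_left (Real.sqrt_le_sqrt ?_) hK)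
      push_cast
      linarith
    refine (norm_add_le _ _).trans ?_
    rw [lp.norm_single (by norm_num), lp.norm_single (by norm_num)]
    linarith

theorem inner_jacobiSingle {p : lp E 2 × lp E 2} (hp : p ∈ jacobiGraph c) (n : ℕ) (v : E n) :
    (inner ℂ (jacobiSingle c n v) p.1 : ℂ) = inner ℂ (lp.single 2 n v) p.2 := by
  rw [lp.inner_single_left, hp.2]
  rcases n with _ | n
  · rw [jacobiSingle, lp.inner_single_left, jacobiComponent, ContinuousLinearMap.adjoint_inner_right]
  · rw [jacobiSingle, inner_add_left, lp.inner_single_left, lp.inner_single_left, jacobiComponent,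
      inner_add_right, ContinuousLinearMap.adjoint_inner_right,
      ContinuousLinearMap.adjoint_inner_left, add_comm]

/-- The vector `(c + c†) φ`, for `φ` with components vanishing from `N` on. -/
theorem sum_jacobiSingle_mem {φ : lp E 2} {N : ℕ} (hN : ∀ n, N ≤ n → φ n = 0) :
    (φ, ∑ n ∈ Finset.range N, jacobiSingle c n (φ n)) ∈ jacobiGraph c := by
  have h := (jacobiGraph c).sum_mem (t := Finset.range N)
    fun n _ => single_jacobiSingle_mem (c := c) n (φ n)
  rwa [← prod_mk_sum, sum_single_eq hN] at h

/-- By linearity in the finite particle vector `p.1` it is enough to treat single components, where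
the adjoint blocks move across the inner product. -/
theorem jacobiGraph_symmetric {p q : lp E 2 × lp E 2} (hp : p ∈ jacobiGraph c)
    (hq : q ∈ jacobiGraph c) : (inner ℂ p.2 q.1 : ℂ) = inner ℂ p.1 q.2 := by
  obtain ⟨N, hN⟩ := hp.1
  have h2 : p.2 = ∑ n ∈ Finset.range N, jacobiSingle c n (p.1 n) := by
    ext1
    funext n
    rw [hp.2, (sum_jacobiSingle_mem hN).2]
  rw [h2, sum_inner]
  nth_rw 2 [← sum_single_eq hN]
  rw [sum_inner]
  exact Finset.sum_congr rfl fun n _ => inner_jacobiSingle hq n _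

/-- Essential self-adjointness of a block Jacobi operator whose off-diagonal blocks grow at most
like `√n`: the deficiency spaces are trivial. -/
theorem eq_zero_of_forall_inner_jacobiGraph {K : ℝ} (hc : ∀ n, ‖c n‖ ≤ K * √(n + 1)) {w : ℂ}
    (hw : w.im ≠ 0) {η : lp E 2}
    (hη : ∀ p ∈ jacobiGraph c, (inner ℂ (w • p.1 - p.2) η : ℂ) = 0) : η = 0 := by
  have hK : 0 ≤ K := by simpa using (norm_nonneg _).trans (hc 0)
  have h1 : ∀ n, (starRingEnd ℂ) w * ((‖η n‖ ^ 2 : ℝ) : ℂ) =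
      inner ℂ (jacobiSingle c n (η n)) η := by
    intro n
    have h := hη _ (single_jacobiSingle_mem n (η n))
    rw [inner_sub_left, inner_smul_left, lp.inner_single_left, inner_self_eq_norm_sq_to_K,
      sub_eq_zero] at h
    rw [← h]
    norm_cast
  -- Testing against the single components of `η` gives a three-term recurrence. In the imaginary
  -- parts the off-diagonal terms telescope, leaving one boundary term.
  have htel : ∀ N, -(w.im * ∑ n ∈ Finset.range (N + 1), ‖η n‖ ^ 2) =
      (inner ℂ (c N (η N)) (η (N + 1)) : ℂ).im := by
    intro N
    induction N with
    | zero =>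
      have h := congrArg Complex.im (h1 0)
      rw [jacobiSingle, lp.inner_single_left, Complex.im_mul_ofReal, Complex.conj_im] at h
      simpa using h
    | succ N ih =>
      have h := congrArg Complex.im (h1 (N + 1))
      rw [jacobiSingle, inner_add_left, lp.inner_single_left, lp.inner_single_left,
        ContinuousLinearMap.adjoint_inner_left, Complex.im_mul_ofReal, Complex.conj_im,
        Complex.add_im, ← inner_conj_symm (η (N + 1)), Complex.conj_im] at h
      rw [Finset.sum_range_succ, mul_add, neg_add, ih]
      linarith
  by_contra hne
  obtain ⟨m, hm⟩ : ∃ m, η m ≠ 0 := by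
    by_contra! h
    exact hne (by ext1; funext n; exact h n)
  have hS : Summable fun n => ‖η n‖ * ‖η (n + 1)‖ := by
    have hs : Summable fun n => ‖η n‖ ^ 2 := by
      have := (lp.memℓp η).summable (by norm_num)
      simpa using this
    have hs' := (summable_nat_add_iff 1).mpr hs
    refine Summable.of_nonneg_of_le (fun n => by positivity) (fun n => ?_) (hs.add hs')
    nlinarith [sq_nonneg (‖η n‖ - ‖η (n + 1)‖), sq_nonneg (‖η n‖), sq_nonneg ‖η (n + 1)‖]
  have hpos : 0 < |w.im| * ‖η m‖ ^ 2 := by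
    have := norm_pos_iff.mpr hm
    have := abs_pos.mpr hw
    positivity
  -- If $\eta_m\ne0$, every later boundary term is bounded away from zero, although the products
  -- $\|\eta_N\|\|\eta_{N+1}\|$ are summable.
  have hlow : ∀ N, m ≤ N → |w.im| * ‖η m‖ ^ 2 ≤ K * √(N + 1) * (‖η N‖ * ‖η (N + 1)‖) := by
    intro N hN
    have ha : ‖η m‖ ^ 2 ≤ ∑ n ∈ Finset.range (N + 1), ‖η n‖ ^ 2 :=
      Finset.single_le_sum (f := fun n => ‖η n‖ ^ 2) (fun n _ => sq_nonneg _)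
        (Finset.mem_range.mpr (by omega))
    calc |w.im| * ‖η m‖ ^ 2 ≤ |w.im| * ∑ n ∈ Finset.range (N + 1), ‖η n‖ ^ 2 := by gcongr
      _ = |(inner ℂ (c N (η N)) (η (N + 1)) : ℂ).im| := by
        rw [← htel N, abs_neg, abs_mul,
          abs_of_nonneg (a := ∑ n ∈ Finset.range (N + 1), ‖η n‖ ^ 2)
            (Finset.sum_nonneg fun n _ => sq_nonneg _)]
      _ ≤ ‖c N (η N)‖ * ‖η (N + 1)‖ :=
        (Complex.abs_im_le_norm _).trans (norm_inner_le_norm _ _)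
      _ ≤ K * √(N + 1) * ‖η N‖ * ‖η (N + 1)‖ := by
        gcongr
        exact (c N).le_of_opNorm_le (hc N) _
      _ = _ := by ring
  have hK0 : 0 < K := by
    rcases hK.eq_or_lt with h | h
    · have := hlow m le_rfl
      rw [← h] at this
      linarith
    · exact h
  -- The crude estimate $\sqrt{N+1}\le N+1$ suffices: it would make the harmonic series converge.
  have hdiv : ¬ Summable fun n : ℕ => ((n : ℝ) + 1)⁻¹ := by
    have := mt (summable_nat_add_iff (f := fun n : ℕ => ((n : ℝ))⁻¹) 1).mp
      Real.not_summable_natCast_inv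
    simpa using this
  refine hdiv ((summable_nat_add_iff m).mp ?_)
  refine Summable.of_nonneg_of_le (fun n => by positivity) (fun n => ?_)
    (((summable_nat_add_iff m).mpr hS).mul_left (K / (|w.im| * ‖η m‖ ^ 2)))
  have hl := hlow (n + m) (by omega)
  have hs1 : √(((n + m : ℕ) : ℝ) + 1) ≤ ((n + m : ℕ) : ℝ) + 1 := by
    refine Real.sqrt_le_iff.mpr ⟨by positivity, ?_⟩
    have : (0 : ℝ) ≤ ((n + m : ℕ) : ℝ) := by positivity
    nlinarith
  rw [div_mul_eq_mul_div, inv_eq_one_div, div_le_div_iff₀ (by positivity) hpos, one_mul]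
  refine hl.trans ?_
  calc K * √(((n + m : ℕ) : ℝ) + 1) * (‖η (n + m)‖ * ‖η (n + m + 1)‖)
      ≤ K * (((n + m : ℕ) : ℝ) + 1) * (‖η (n + m)‖ * ‖η (n + m + 1)‖) := by gcongr
    _ = _ := by ring

theorem exists_isResolvent_jacobi {K : ℝ} (hc : ∀ n, ‖c n‖ ≤ K * √(n + 1)) {w : ℂ}
    (hw : w.im ≠ 0) :
    ∃ R, IsResolvent (closure (jacobiGraph c : Set (lp E 2 × lp E 2))) w R ∧ ‖R‖ ≤ |w.im|⁻¹ :=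
  exists_isResolvent_closure _ (fun _ hp => jacobiGraph_symmetric hp hp) hw
    fun _ hη => eq_zero_of_forall_inner_jacobiGraph hc hw hη

/-- Strong resolvent convergence to zero of block Jacobi operators with vanishing blocks. -/
theorem tendsto_resolvent_jacobi {ι : Type*} {l : Filter ι}
    {C : ι → ∀ n, E n →L[ℂ] E (n + 1)} {K : ι → ℝ} (hC : ∀ i n, ‖C i n‖ ≤ K i * √(n + 1))
    (hK : Tendsto K l (𝓝 0)) {w : ℂ} (hw : w.im ≠ 0) {R : ι → lp E 2 →L[ℂ] lp E 2}
    (hR : ∀ i, IsResolvent (closure (jacobiGraph (C i) : Set (lp E 2 × lp E 2))) w (R i))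
    (hRn : ∀ i, ‖R i‖ ≤ |w.im|⁻¹) (ψ : lp E 2) :
    Tendsto (fun i => R i ψ) l (𝓝 ((1 / w) • ψ)) := by
  have hw0 : w ≠ 0 := fun h => hw (by simp [h])
  have hsingle : ∀ n (v : E n), Tendsto (fun i => R i (lp.single 2 n v)) l
      (𝓝 ((1 / w) • lp.single 2 n v)) := by
    intro n v
    rw [tendsto_iff_norm_sub_tendsto_zero]
    have hb : ∀ i, ‖R i (lp.single 2 n v) - (1 / w) • lp.single 2 n v‖ ≤
        ‖w‖⁻¹ * (|w.im|⁻¹ * (K i * (2 * √(n + 1) * ‖v‖))) := by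
      intro i
      -- Applying $R(w-A)\varphi=\varphi$ to a single component yields
      -- $R\varphi-w^{-1}\varphi=w^{-1}RA\varphi$.
      have h := (hR i).2 _ (subset_closure (single_jacobiSingle_mem n v))
      rw [map_sub, map_smul, sub_eq_iff_eq_add] at h
      have h2 : R i (lp.single 2 n v) - (1 / w) • lp.single 2 n v =
          w⁻¹ • R i (jacobiSingle (C i) n v) := by
        rw [one_div, ← smul_right_injective _ hw0 |>.eq_iff]
        simp only [smul_sub, smul_smul, mul_inv_cancel₀ hw0, one_smul, h]
        abel
      rw [h2, norm_smul, norm_inv]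
      gcongr
      exact (R i).le_of_opNorm_le_of_le (hRn i) (norm_jacobiSingle_le (hC i) n v)
    refine squeeze_zero (fun i => norm_nonneg _) hb ?_
    simpa using ((hK.mul_const (2 * √(n + 1) * ‖v‖)).const_mul |w.im|⁻¹).const_mul ‖w‖⁻¹
  have hsum : ∀ s : Finset ℕ, Tendsto (fun i => R i (∑ n ∈ s, lp.single 2 n (ψ n))) l
      (𝓝 ((1 / w) • ∑ n ∈ s, lp.single 2 n (ψ n))) := by
    intro s
    simp only [map_sum, Finset.smul_sum]
    exact tendsto_finsetSum _ fun n _ => hsingle n _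
  rw [Metric.tendsto_nhds]
  intro ε hε
  have hψ := lp.hasSum_single (p := 2) (by norm_num) ψ
  -- `A` dominates $\|R_i\|+\|1/w\|$ uniformly in `i`; the added 1 makes its positivity immediate.
  set A := |w.im|⁻¹ + ‖1 / w‖ + 1 with hA
  have hA0 : 0 < A := by positivity
  obtain ⟨s, hs⟩ := ((Metric.tendsto_nhds.mp hψ) (ε / (2 * A)) (by positivity)).exists
  filter_upwards [(Metric.tendsto_nhds.mp (hsum s)) (ε / 2) (by positivity)] with i hi
  set φ := ∑ n ∈ s, lp.single 2 n (ψ n)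
  rw [dist_eq_norm] at hs hi ⊢
  have e : R i ψ - (1 / w) • ψ =
      R i (ψ - φ) - (1 / w) • (ψ - φ) + (R i φ - (1 / w) • φ) := by
    rw [map_sub, smul_sub]
    abel
  have h1 : ‖R i (ψ - φ)‖ ≤ |w.im|⁻¹ * ‖ψ - φ‖ := (R i).le_of_opNorm_le (hRn i) _
  have h2 : ‖(1 / w) • (ψ - φ)‖ = ‖1 / w‖ * ‖ψ - φ‖ := norm_smul _ _
  have h3 : ‖ψ - φ‖ < ε / (2 * A) := by rwa [norm_sub_rev]
  have h4 : A * ‖ψ - φ‖ < ε / 2 := by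
    have := mul_lt_mul_of_pos_left h3 hA0
    rwa [show A * (ε / (2 * A)) = ε / 2 by field_simp] at this
  have h5 := norm_nonneg (ψ - φ)
  calc _ ≤ ‖R i (ψ - φ)‖ + ‖(1 / w) • (ψ - φ)‖ + ‖R i φ - (1 / w) • φ‖ := by
        rw [e]
        exact (norm_add_le _ _).trans (add_le_add_left (norm_sub_le _ _) _)
    _ < ε := by nlinarith

end Jacobi

/-! ### Creation and annihilation operators -/

section Product

variable {X Y : Type*} [MeasurableSpace X] [MeasurableSpace Y] {μ : Measure X} {ν : Measure Y}

theorem lintegral_enorm_sq_eq {f : X → ℂ} :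
    ∫⁻ x, ‖f x‖ₑ ^ 2 ∂μ = eLpNorm f 2 μ ^ 2 := by
  have h := eLpNorm_nnreal_pow_eq_lintegral (p := 2) (f := f) (μ := μ) two_ne_zero
  norm_cast at h
  simpa only [ENNReal.rpow_two] using h.symm

variable [SigmaFinite ν]

theorem eLpNorm_mul_prod {f : X → ℂ} {g : Y → ℂ} (hf : AEStronglyMeasurable f μ)
    (hg : AEStronglyMeasurable g ν) :
    eLpNorm (fun q : X × Y => f q.1 * g q.2) 2 (μ.prod ν) = eLpNorm f 2 μ * eLpNorm g 2 ν := by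
  have h : eLpNorm (fun q : X × Y => f q.1 * g q.2) 2 (μ.prod ν) ^ 2
      = (eLpNorm f 2 μ * eLpNorm g 2 ν) ^ 2 := by
    rw [← lintegral_enorm_sq_eq, mul_pow, ← lintegral_enorm_sq_eq, ← lintegral_enorm_sq_eq,
      ← lintegral_prod_mul (hf.enorm.pow_const 2) (hg.enorm.pow_const 2)]
    simp_rw [enorm_mul, mul_pow]
  exact (ENNReal.pow_right_strictMono two_ne_zero).injective h

theorem memLp_mul_prod {f : X → ℂ} {g : Y → ℂ} (hf : MemLp f 2 μ) (hg : MemLp g 2 ν) :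
    MemLp (fun q : X × Y => f q.1 * g q.2) 2 (μ.prod ν) := by
  refine ⟨(hf.1.comp_fst).mul (hg.1.comp_snd), ?_⟩
  rw [eLpNorm_mul_prod hf.1 hg.1]
  exact ENNReal.mul_lt_top hf.2 hg.2

end Product

section CreationAnnihilation

variable {X : Type*} [MeasurableSpace X] {μ : Measure X} [SigmaFinite μ] {n : ℕ}

variable (X n) in
/-- Splitting off the first variable. -/
def headTail : (Fin (n + 1) → X) ≃ᵐ X × (Fin n → X) :=
  MeasurableEquiv.piFinSuccAbove (fun _ => X) 0

theorem headTail_apply (x : Fin (n + 1) → X) : headTail X n x = (x 0, Fin.tail x) := by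
  refine Prod.ext rfl (funext fun i => ?_)
  change x (Fin.succAbove 0 i) = x i.succ
  rw [Fin.zero_succAbove]

theorem headTail_symm_apply (y : X) (x : Fin n → X) :
    (headTail X n).symm (y, x) = Fin.cons y x := by
  rw [MeasurableEquiv.symm_apply_eq, headTail_apply, Fin.cons_zero, Fin.tail_cons]

variable (μ n) in
theorem measurePreserving_headTail :
    MeasurePreserving (headTail X n) (Measure.pi fun _ => μ)
      (μ.prod (Measure.pi fun _ : Fin n => μ)) :=
  measurePreserving_piFinSuccAbove (fun _ => μ) 0

variable (μ n) in
theorem quasiMeasurePreserving_tail :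
    Measure.QuasiMeasurePreserving (Fin.tail : (Fin (n + 1) → X) → Fin n → X)
      (Measure.pi fun _ => μ) (Measure.pi fun _ => μ) := by
  have h := Measure.quasiMeasurePreserving_snd.comp
    (measurePreserving_headTail μ n).quasiMeasurePreserving
  convert h using 1
  funext x
  exact (congrArg Prod.snd (headTail_apply x)).symm

theorem memLp_front {g : X → ℂ} (hg : MemLp g 2 μ) (φ : NParticle μ n) :
    MemLp (fun x : Fin (n + 1) → X => g (x 0) * φ (Fin.tail x)) 2 (Measure.pi fun _ => μ) := by
  have h := (memLp_mul_prod hg (Lp.memLp φ)).comp_measurePreserving (measurePreserving_headTail μ n)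
  convert h using 1
  funext x
  simp only [Function.comp, headTail_apply]

/-- The operator `φ ↦ g ⊗ φ`. -/
def frontTensor (g : X → ℂ) (hg : MemLp g 2 μ) (n : ℕ) : NParticle μ n →L[ℂ] NParticle μ (n + 1) :=
  LinearMap.mkContinuous
    { toFun := fun φ => (memLp_front hg φ).toLp
      map_add' := fun φ ψ => by
        rw [← MemLp.toLp_add]
        refine MemLp.toLp_congr _ _ ?_
        filter_upwards [(quasiMeasurePreserving_tail μ n).ae (Lp.coeFn_add φ ψ)] with x hx
        simp only [hx, Pi.add_apply, mul_add]
      map_smul' := fun z φ => by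
        rw [RingHom.id_apply, ← MemLp.toLp_const_smul]
        refine MemLp.toLp_congr _ _ ?_
        filter_upwards [(quasiMeasurePreserving_tail μ n).ae (Lp.coeFn_smul z φ)] with x hx
        simp only [hx, Pi.smul_apply, smul_eq_mul]
        ring }
    (eLpNorm g 2 μ).toReal fun φ => by
      have h := eLpNorm_mul_prod hg.1 (Lp.memLp φ).1
      rw [← eLpNorm_comp_measurePreserving (memLp_mul_prod hg (Lp.memLp φ)).1
        (measurePreserving_headTail μ n)] at h
      change ‖(memLp_front hg φ).toLp _‖ ≤ _
      rw [Lp.norm_toLp, Lp.norm_def, ← ENNReal.toReal_mul, ← h]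
      refine le_of_eq (congrArg _ (congrArg (eLpNorm · 2 _) ?_))
      funext x
      simp only [Function.comp, headTail_apply]

theorem norm_frontTensor_le (g : X → ℂ) (hg : MemLp g 2 μ) :
    ‖frontTensor g hg n‖ ≤ (eLpNorm g 2 μ).toReal :=
  LinearMap.mkContinuous_norm_le _ ENNReal.toReal_nonneg _

theorem coeFn_frontTensor (g : X → ℂ) (hg : MemLp g 2 μ) (φ : NParticle μ n) :
    frontTensor g hg n φ =ᵐ[Measure.pi fun _ => μ] fun x => g (x 0) * φ (Fin.tail x) :=
  (memLp_front hg φ).coeFn_toLp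

/-- The pointwise formula for the adjoint of `φ ↦ g ⊗ φ`. -/
theorem coeFn_adjoint_frontTensor (g : X → ℂ) (hg : MemLp g 2 μ) (ψ : NParticle μ (n + 1)) :
    (frontTensor g hg n).adjoint ψ =ᵐ[Measure.pi fun _ => μ]
      fun x => ∫ y, (starRingEnd ℂ) (g y) * ψ (Fin.cons y x) ∂μ := by
  -- The two functions are compared through their integrals over sets of finite measure, that is, by
  -- testing the adjoint against indicators.
  have key : ∀ s : Set (Fin n → X), MeasurableSet s → (Measure.pi fun _ => μ) s < ∞ →
      IntegrableOn (fun x => ∫ y, (starRingEnd ℂ) (g y) * ψ (Fin.cons y x) ∂μ) s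
        (Measure.pi fun _ => μ) ∧
      ∫ x in s, (frontTensor g hg n).adjoint ψ x ∂(Measure.pi fun _ => μ) =
        ∫ x in s, ∫ y, (starRingEnd ℂ) (g y) * ψ (Fin.cons y x) ∂μ ∂(Measure.pi fun _ => μ) := by
    intro s hs hμs
    set φ : NParticle μ n := indicatorConstLp 2 hs hμs.ne 1 with hφ
    -- Integrability of this $L^2$ pairing is what licenses Fubini after the first variable is split
    -- off.
    have hint := L2.integrable_inner (𝕜 := ℂ) (frontTensor g hg n φ) ψ
    have hae : (fun x => (inner ℂ (frontTensor g hg n φ x) (ψ x) : ℂ))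
        =ᵐ[Measure.pi fun _ => μ] fun x =>
          (s.indicator (fun _ => (starRingEnd ℂ) (g (x 0)) * ψ x) (Fin.tail x) : ℂ) := by
      filter_upwards [coeFn_frontTensor g hg φ, (quasiMeasurePreserving_tail μ n).ae
        (indicatorConstLp_coeFn (p := 2) (hs := hs) (hμs := hμs.ne) (c := (1 : ℂ)))] with x h1 h2
      rw [h1, hφ, h2]
      by_cases hx : Fin.tail x ∈ s
      · simp [hx, mul_comm]
      · simp [hx]
    have hmp := (measurePreserving_headTail μ n).symm
    have hint' := (hmp.integrable_comp_emb (MeasurableEquiv.measurableEmbedding _)).mpr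
      (hint.congr hae)
    have hfun : ((fun x : Fin (n + 1) → X =>
        (s.indicator (fun _ => (starRingEnd ℂ) (g (x 0)) * ψ x) (Fin.tail x) : ℂ)) ∘
          (headTail X n).symm) = fun q : X × (Fin n → X) =>
        s.indicator (fun x => (starRingEnd ℂ) (g q.1) * ψ (Fin.cons q.1 x)) q.2 := by
      funext q
      obtain ⟨y, x⟩ := q
      simp only [Function.comp, headTail_symm_apply, Fin.cons_zero, Fin.tail_cons]
      by_cases hx : x ∈ s <;> simp [hx]
    have hslice : ∀ x, ∫ y, s.indicator (fun x => (starRingEnd ℂ) (g y) * ψ (Fin.cons y x)) x ∂μ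
        = s.indicator (fun x => ∫ y, (starRingEnd ℂ) (g y) * ψ (Fin.cons y x) ∂μ) x := by
      intro x
      by_cases hx : x ∈ s <;> simp [hx]
    rw [hfun] at hint'
    have hr := hint'.integral_prod_right
    simp only [hslice] at hr
    refine ⟨(integrable_indicator_iff hs).mp hr, ?_⟩
    rw [← L2.inner_indicatorConstLp_one hs hμs.ne, ← hφ, ContinuousLinearMap.adjoint_inner_right,
      L2.inner_def, integral_congr_ae hae, ← hmp.integral_comp',
      ← integral_indicator hs]
    have := integral_prod_symm _ hint'
    simp only [hslice] at this
    rw [← this]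
    exact congrArg (fun f => integral _ f) hfun
  exact ae_eq_of_forall_setIntegral_eq_of_sigmaFinite
    (fun s _ hμs => integrableOn_Lp_of_measure_ne_top _ (by norm_num) hμs.ne)
    (fun s hs hμs => (key s hs hμs).1) (fun s hs hμs => (key s hs hμs).2)

variable (μ) in
/-- Permutation of the variables. -/
def permute (σ : Equiv.Perm (Fin n)) : NParticle μ n →ₗᵢ[ℂ] NParticle μ n :=
  Lp.compMeasurePreservingₗᵢ ℂ (fun x : Fin n → X => x ∘ σ) (measurePreserving_comp_perm μ n σ)

theorem mem_symmetricSubspace {ψ : NParticle μ n} :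
    ψ ∈ symmetricSubspace μ n ↔ ∀ σ, permute μ σ ψ = ψ := Iff.rfl

theorem coeFn_permute (σ : Equiv.Perm (Fin n)) (ψ : NParticle μ n) :
    permute μ σ ψ =ᵐ[Measure.pi fun _ => μ] fun x => ψ (x ∘ σ) :=
  Lp.coeFn_compMeasurePreserving ψ (measurePreserving_comp_perm μ n σ)

theorem permute_permute (σ τ : Equiv.Perm (Fin n)) (ψ : NParticle μ n) :
    permute μ σ (permute μ τ ψ) = permute μ (σ * τ) ψ := by
  refine Lp.ext ?_
  filter_upwards [coeFn_permute σ (permute μ τ ψ), coeFn_permute (σ * τ) ψ,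
    (measurePreserving_comp_perm μ n σ).quasiMeasurePreserving.ae (coeFn_permute τ ψ)]
    with x h1 h2 h3
  rw [h1, h2, h3]
  rfl

/-- The extension of `σ` fixes the slot of `g` and acts by `σ` on the remaining variables. -/
theorem permute_frontTensor (g : X → ℂ) (hg : MemLp g 2 μ) (σ : Equiv.Perm (Fin n))
    (φ : NParticle μ n) :
    permute μ (Equiv.Perm.decomposeFin.symm (0, σ)) (frontTensor g hg n φ) =
      frontTensor g hg n (permute μ σ φ) := by
  refine Lp.ext ?_
  filter_upwards [coeFn_permute (Equiv.Perm.decomposeFin.symm (0, σ)) (frontTensor g hg n φ),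
    (measurePreserving_comp_perm μ _ (Equiv.Perm.decomposeFin.symm
      (0, σ))).quasiMeasurePreserving.ae (coeFn_frontTensor g hg φ),
    coeFn_frontTensor g hg (permute μ σ φ),
    (quasiMeasurePreserving_tail μ n).ae (coeFn_permute σ φ)] with x h1 h2 h3 h4
  rw [h1, h2, h3, h4]
  have : Fin.tail (x ∘ Equiv.Perm.decomposeFin.symm (0, σ)) = Fin.tail x ∘ σ := by
    funext i
    simp [Fin.tail]
  rw [this]
  simp

theorem exists_decomposeFin_eq {ρ : Equiv.Perm (Fin (n + 1))} (hρ : ρ 0 = 0) :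
    ∃ σ, ρ = Equiv.Perm.decomposeFin.symm (0, σ) := by
  obtain ⟨⟨p, σ⟩, rfl⟩ := Equiv.Perm.decomposeFin.symm.surjective ρ
  rw [Equiv.Perm.decomposeFin_symm_apply_zero] at hρ
  exact ⟨σ, by rw [hρ]⟩

theorem permute_frontTensor_of_fixed (g : X → ℂ) (hg : MemLp g 2 μ) {φ : NParticle μ n}
    (hφ : φ ∈ symmetricSubspace μ n) {ρ : Equiv.Perm (Fin (n + 1))} (hρ : ρ 0 = 0) :
    permute μ ρ (frontTensor g hg n φ) = frontTensor g hg n φ := by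
  obtain ⟨σ, rfl⟩ := exists_decomposeFin_eq hρ
  rw [permute_frontTensor, mem_symmetricSubspace.mp hφ]

/-- By duality: a permutation of the last `n` variables passes through $\varphi\mapsto
g\otimes\varphi$ to a permutation fixing 0, under which `ψ` is invariant. -/
theorem adjoint_frontTensor_mem (g : X → ℂ) (hg : MemLp g 2 μ) {ψ : NParticle μ (n + 1)}
    (hψ : ψ ∈ symmetricSubspace μ (n + 1)) :
    (frontTensor g hg n).adjoint ψ ∈ symmetricSubspace μ n := by
  intro σ
  refine ext_inner_left ℂ fun φ => ?_
  change inner ℂ φ (permute μ σ _) = _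
  have h : φ = permute μ σ (permute μ σ⁻¹ φ) := by
    rw [permute_permute, mul_inv_cancel]
    refine Lp.ext ?_
    filter_upwards [coeFn_permute 1 φ] with x hx
    rw [hx]
    rfl
  rw [ContinuousLinearMap.adjoint_inner_right]
  nth_rw 2 [h]
  rw [← permute_frontTensor]
  nth_rw 2 [← mem_symmetricSubspace.mp hψ (Equiv.Perm.decomposeFin.symm (0, σ))]
  rw [LinearIsometry.inner_map_map, ← ContinuousLinearMap.adjoint_inner_right]
  nth_rw 1 [h]
  rw [LinearIsometry.inner_map_map]

/-- `∑ⱼ g(xⱼ) φ(x₀, …, x̂ⱼ, …, xₙ)` as an operator. -/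
def tensorSum (g : X → ℂ) (hg : MemLp g 2 μ) (n : ℕ) : NParticle μ n →L[ℂ] NParticle μ (n + 1) :=
  ∑ j : Fin (n + 1), (permute μ j.cycleRange.symm).toContinuousLinearMap ∘L frontTensor g hg n

theorem tensorSum_apply (g : X → ℂ) (hg : MemLp g 2 μ) (φ : NParticle μ n) :
    tensorSum g hg n φ = ∑ j : Fin (n + 1), permute μ j.cycleRange.symm (frontTensor g hg n φ) := by
  simp [tensorSum]

/-- The inverse cycle of `j` sends 0 to `j` and `i.succ` to `j.succAbove i`, so it moves `g` into
slot `j` and keeps the other variables in order. -/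
theorem coeFn_tensorSum (g : X → ℂ) (hg : MemLp g 2 μ) (φ : NParticle μ n) :
    tensorSum g hg n φ =ᵐ[Measure.pi fun _ => μ]
      fun x => ∑ j : Fin (n + 1), g (x j) * φ (fun i => x (j.succAbove i)) := by
  rw [tensorSum_apply]
  have h : ∀ j : Fin (n + 1), ∀ᵐ x ∂(Measure.pi fun _ => μ),
      permute μ j.cycleRange.symm (frontTensor g hg n φ) x =
        g (x j) * φ (fun i => x (j.succAbove i)) := by
    intro j
    filter_upwards [coeFn_permute j.cycleRange.symm (frontTensor g hg n φ),
      (measurePreserving_comp_perm μ _ j.cycleRange.symm).quasiMeasurePreserving.ae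
        (coeFn_frontTensor g hg φ)] with x h1 h2
    rw [h1, h2]
    have : Fin.tail (x ∘ j.cycleRange.symm) = fun i => x (j.succAbove i) := by
      funext i
      simp [Fin.tail, Fin.cycleRange_symm_succ]
    rw [this]
    simp [Fin.cycleRange_symm_zero]
  filter_upwards [Lp.coeFn_finsetSum Finset.univ
    (fun j : Fin (n + 1) => permute μ j.cycleRange.symm (frontTensor g hg n φ)),
    ae_all_iff.mpr h] with x h1 h2
  rw [h1, Finset.sum_apply]
  exact Finset.sum_congr rfl fun j _ => h2 j

/-- A permutation `τ` takes the summand of `j` to that of `τ j`: the two permutations involved both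
send 0 to `τ j`, so they differ by one fixing 0, which leaves $g\otimes\varphi$ unchanged. -/
theorem tensorSum_mem (g : X → ℂ) (hg : MemLp g 2 μ) {φ : NParticle μ n}
    (hφ : φ ∈ symmetricSubspace μ n) : tensorSum g hg n φ ∈ symmetricSubspace μ (n + 1) := by
  rw [mem_symmetricSubspace]
  intro τ
  rw [tensorSum_apply, map_sum]
  refine Fintype.sum_equiv τ _ _ fun j => ?_
  have h0 : ((τ j).cycleRange.symm⁻¹ * (τ * j.cycleRange.symm)) 0 = 0 := by
    simp only [Equiv.Perm.mul_apply, Fin.cycleRange_symm_zero]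
    rw [Equiv.Perm.inv_eq_iff_eq, Fin.cycleRange_symm_zero]
  conv_rhs => rw [← permute_frontTensor_of_fixed g hg hφ h0]
  rw [permute_permute, permute_permute, mul_inv_cancel_left]

/-- All $n+1$ summands pair equally with a symmetric `ψ`, since permutations are isometries fixing
it. -/
theorem inner_tensorSum (g : X → ℂ) (hg : MemLp g 2 μ) (φ : NParticle μ n)
    {ψ : NParticle μ (n + 1)} (hψ : ψ ∈ symmetricSubspace μ (n + 1)) :
    (inner ℂ (tensorSum g hg n φ) ψ : ℂ) =
      (n + 1) * inner ℂ φ ((frontTensor g hg n).adjoint ψ) := by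
  rw [tensorSum_apply, sum_inner]
  have : ∀ j : Fin (n + 1), (inner ℂ (permute μ j.cycleRange.symm (frontTensor g hg n φ)) ψ : ℂ)
      = inner ℂ φ ((frontTensor g hg n).adjoint ψ) := by
    intro j
    nth_rw 1 [← mem_symmetricSubspace.mp hψ j.cycleRange.symm]
    rw [LinearIsometry.inner_map_map, ContinuousLinearMap.adjoint_inner_right]
  simp [this]

/-- The triangle inequality suffices: the normalisation $(n+1)^{-1/2}$ of the creation operator
reduces the factor $n+1$ to the $\sqrt{n+1}$ growth needed for Jacobi blocks. -/
theorem norm_tensorSum_apply_le (g : X → ℂ) (hg : MemLp g 2 μ) (φ : NParticle μ n) :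
    ‖tensorSum g hg n φ‖ ≤ (n + 1) * ((eLpNorm g 2 μ).toReal * ‖φ‖) := by
  rw [tensorSum_apply]
  refine (norm_sum_le _ _).trans ?_
  have : ∀ j : Fin (n + 1), ‖permute μ j.cycleRange.symm (frontTensor g hg n φ)‖ ≤
      (eLpNorm g 2 μ).toReal * ‖φ‖ := fun j => by
    rw [LinearIsometry.norm_map]
    exact (frontTensor g hg n).le_of_opNorm_le (norm_frontTensor_le g hg) φ
  refine (Finset.sum_le_sum fun j _ => this j).trans ?_
  simp

end CreationAnnihilation

/-! ### Segal fields -/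

section Segal

variable {X : Type*} [MeasurableSpace X] {μ : Measure X} [SigmaFinite μ]

instance (n : ℕ) : CompleteSpace (symmetricSubspace μ n) := by
  refine IsClosed.completeSpace_coe (hs := ?_)
  have : (symmetricSubspace μ n : Set (NParticle μ n)) = ⋂ σ, {ψ | permute μ σ ψ = ψ} := by
    ext ψ
    simp [mem_symmetricSubspace]
  rw [this]
  exact isClosed_iInter fun σ => isClosed_eq (permute μ σ).continuous continuous_id

/-- The operator `2^{-1/2} a*(g)` on the symmetric `n`-particle space. -/
def fockCreation (g : X → ℂ) (hg : MemLp g 2 μ) (n : ℕ) :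
    symmetricSubspace μ n →L[ℂ] symmetricSubspace μ (n + 1) :=
  (((√2)⁻¹ * (√((n : ℝ) + 1))⁻¹ : ℝ) : ℂ) •
    (tensorSum g hg n ∘L (symmetricSubspace μ n).subtypeL).codRestrict _
      fun φ => tensorSum_mem g hg φ.2

theorem coe_fockCreation (g : X → ℂ) (hg : MemLp g 2 μ) (n : ℕ) (φ : symmetricSubspace μ n) :
    (fockCreation g hg n φ : NParticle μ (n + 1)) =
      (((√2)⁻¹ * (√((n : ℝ) + 1))⁻¹ : ℝ) : ℂ) • tensorSum g hg n φ := rfl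

theorem norm_fockCreation_le (g : X → ℂ) (hg : MemLp g 2 μ) (n : ℕ) :
    ‖fockCreation g hg n‖ ≤ (√2)⁻¹ * (eLpNorm g 2 μ).toReal * √((n : ℝ) + 1) := by
  refine ContinuousLinearMap.opNorm_le_bound _ (by positivity) fun φ => ?_
  rw [← Submodule.norm_coe, coe_fockCreation, norm_smul, Complex.norm_real, Real.norm_eq_abs,
    abs_of_nonneg (by positivity)]
  have h := norm_tensorSum_apply_le g hg (φ : NParticle μ n)
  have hn : (0 : ℝ) < √((n : ℝ) + 1) := by positivity
  calc _ ≤ (√2)⁻¹ * (√((n : ℝ) + 1))⁻¹ *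
        (((n : ℝ) + 1) * ((eLpNorm g 2 μ).toReal * ‖(φ : NParticle μ n)‖)) := by gcongr
    _ = (√2)⁻¹ * (√((n : ℝ) + 1))⁻¹ * ((√((n : ℝ) + 1) * √((n : ℝ) + 1)) *
        ((eLpNorm g 2 μ).toReal * ‖(φ : NParticle μ n)‖)) := by
      rw [Real.mul_self_sqrt (by positivity)]
    _ = _ := by
      rw [Submodule.norm_coe]
      field_simp

/-- On symmetric vectors the adjoint of the sum is $n+1$ times the adjoint of one term, and
$(n+1)(n+1)^{-1/2}=\sqrt{n+1}$ is the factor in the annihilation operator. -/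
theorem coe_adjoint_fockCreation (g : X → ℂ) (hg : MemLp g 2 μ) (n : ℕ)
    (ψ : symmetricSubspace μ (n + 1)) :
    ((fockCreation g hg n).adjoint ψ : NParticle μ n) =
      (((√2)⁻¹ * √((n : ℝ) + 1) : ℝ) : ℂ) • (frontTensor g hg n).adjoint ψ := by
  have hmem : (((√2)⁻¹ * √((n : ℝ) + 1) : ℝ) : ℂ) •
      (frontTensor g hg n).adjoint (ψ : NParticle μ (n + 1)) ∈ symmetricSubspace μ n :=
    Submodule.smul_mem _ _ (adjoint_frontTensor_mem g hg ψ.2)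
  suffices h : (fockCreation g hg n).adjoint ψ = ⟨_, hmem⟩ from congrArg Subtype.val h
  refine ext_inner_left ℂ fun φ => ?_
  have hn : (√((n : ℝ) + 1)) ≠ 0 := by positivity
  have hsq : (n : ℝ) + 1 = √((n : ℝ) + 1) * √((n : ℝ) + 1) :=
    (Real.mul_self_sqrt (by positivity)).symm
  have hsc : (((√2)⁻¹ * (√((n : ℝ) + 1))⁻¹ : ℝ) : ℂ) * ((n : ℂ) + 1) =
      (((√2)⁻¹ * √((n : ℝ) + 1) : ℝ) : ℂ) := by
    have : (√2)⁻¹ * (√((n : ℝ) + 1))⁻¹ * ((n : ℝ) + 1) = (√2)⁻¹ * √((n : ℝ) + 1) := by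
      nth_rw 2 [hsq]
      field_simp
    exact_mod_cast congrArg (fun x : ℝ => (x : ℂ)) this
  rw [ContinuousLinearMap.adjoint_inner_right, Submodule.coe_inner, Submodule.coe_inner,
    coe_fockCreation, inner_smul_left, inner_tensorSum g hg _ ψ.2, inner_smul_right,
    Complex.conj_ofReal, ← mul_assoc, hsc]

theorem coeFn_fockCreation (g : X → ℂ) (hg : MemLp g 2 μ) (n : ℕ) (φ : symmetricSubspace μ n) :
    (fockCreation g hg n φ : NParticle μ (n + 1)) =ᵐ[Measure.pi fun _ => μ]
      fun x => ((√2 : ℝ) : ℂ)⁻¹ * creation g ((φ : NParticle μ n) : (Fin n → X) → ℂ) x := by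
  rw [coe_fockCreation]
  filter_upwards [Lp.coeFn_smul (((√2)⁻¹ * (√((n : ℝ) + 1))⁻¹ : ℝ) : ℂ)
    (tensorSum g hg n (φ : NParticle μ n)), coeFn_tensorSum g hg (φ : NParticle μ n)] with x h1 h2
  rw [h1, Pi.smul_apply, h2, creation, smul_eq_mul, ← mul_assoc]
  push_cast
  rfl

theorem coeFn_adjoint_fockCreation (g : X → ℂ) (hg : MemLp g 2 μ) (n : ℕ)
    (ψ : symmetricSubspace μ (n + 1)) :
    ((fockCreation g hg n).adjoint ψ : NParticle μ n) =ᵐ[Measure.pi fun _ => μ]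
      fun x => ((√2 : ℝ) : ℂ)⁻¹ *
        annihilation μ g ((ψ : NParticle μ (n + 1)) : (Fin (n + 1) → X) → ℂ) x := by
  rw [coe_adjoint_fockCreation]
  filter_upwards [Lp.coeFn_smul (((√2)⁻¹ * √((n : ℝ) + 1) : ℝ) : ℂ)
    ((frontTensor g hg n).adjoint (ψ : NParticle μ (n + 1))),
    coeFn_adjoint_frontTensor g hg (ψ : NParticle μ (n + 1))] with x h1 h2
  rw [h1, Pi.smul_apply, h2, annihilation, smul_eq_mul, ← mul_assoc]
  push_cast
  rfl

theorem coeFn_jacobiComponent (g : X → ℂ) (hg : MemLp g 2 μ) (ψ : Fock μ) (n : ℕ) :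
    ((jacobiComponent (E := fun n => symmetricSubspace μ n) (fockCreation g hg) ψ n :
      symmetricSubspace μ n) : NParticle μ n) =ᵐ[Measure.pi fun _ => μ] segalComponent g ψ n := by
  rcases n with _ | n
  · exact coeFn_adjoint_fockCreation g hg 0 (ψ 1)
  · filter_upwards [coeFn_adjoint_fockCreation g hg (n + 1) (ψ (n + 2)),
      coeFn_fockCreation g hg n (ψ n), Lp.coeFn_add
        (fockCreation g hg n (ψ n) : NParticle μ (n + 1))
        ((fockCreation g hg (n + 1)).adjoint (ψ (n + 2)) : NParticle μ (n + 1))] with x h1 h2 h3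
    rw [jacobiComponent, Submodule.coe_add, h3, Pi.add_apply, h1, h2]
    exact (mul_add _ _ _).symm

/-- The bridge from pointwise creation and annihilation formulas to the abstract Jacobi theory:
almost everywhere equality is equality in $L^2$. -/
theorem segalGraph_eq (g : X → ℂ) (hg : MemLp g 2 μ) :
    segalGraph g = (jacobiGraph (E := fun n => symmetricSubspace μ n) (fockCreation g hg) :
      Set (Fock μ × Fock μ)) := by
  ext p
  refine and_congr Iff.rfl (forall_congr' fun n => ?_)
  refine ⟨fun h => Subtype.ext (Lp.ext (h.trans (coeFn_jacobiComponent g hg p.1 n).symm)),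
    fun h => ?_⟩
  rw [Fock.component, h]
  exact coeFn_jacobiComponent g hg p.1 n

/-- The Segal field operators are essentially self-adjoint on the finite particle vectors. -/
theorem exists_isResolvent_segalField {g : X → ℂ} (hg : MemLp g 2 μ) {w : ℂ} (hw : w.im ≠ 0) :
    ∃ R, IsResolvent (segalField μ g) w R ∧ ‖R‖ ≤ |w.im|⁻¹ := by
  rw [segalField, segalGraph_eq g hg]
  exact exists_isResolvent_jacobi (norm_fockCreation_le g hg) hw

theorem isResolvent_segalField {g : X → ℂ} (hg : MemLp g 2 μ) {w : ℂ} (hw : w.im ≠ 0) :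
    IsResolvent (segalField μ g) w (resolventOp (segalField μ g) w) := by
  obtain ⟨R, hR, -⟩ := exists_isResolvent_segalField hg hw
  exact hR.isResolvent_resolventOp

theorem norm_resolventOp_segalField_le {g : X → ℂ} (hg : MemLp g 2 μ) {w : ℂ} (hw : w.im ≠ 0) :
    ‖resolventOp (segalField μ g) w‖ ≤ |w.im|⁻¹ := by
  obtain ⟨R, hR, h⟩ := exists_isResolvent_segalField hg hw
  rwa [hR.resolventOp_eq]

theorem tendsto_resolventOp_segalField {ι : Type*} {l : Filter ι} {g : ι → X → ℂ}
    (hg : ∀ i, MemLp (g i) 2 μ) (h0 : Tendsto (fun i => eLpNorm (g i) 2 μ) l (𝓝 0)) {w : ℂ}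
    (hw : w.im ≠ 0) (ψ : Fock μ) :
    Tendsto (fun i => resolventOp (segalField μ (g i)) w ψ) l (𝓝 ((1 / w) • ψ)) := by
  refine tendsto_resolvent_jacobi (C := fun i => fockCreation (g i) (hg i))
    (fun i => norm_fockCreation_le (g i) (hg i)) ?_ hw (fun i => ?_)
    (fun i => norm_resolventOp_segalField_le (hg i) hw) ψ
  · simpa using ((ENNReal.tendsto_toReal ENNReal.zero_ne_top).comp h0).const_mul (√2)⁻¹
  · rw [← segalGraph_eq]
    exact isResolvent_segalField (hg i) hw

/-- A constant family with $g=0$ satisfies the convergence theorem, so its value is the limit. -/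
theorem resolventOp_segalField_zero {w : ℂ} (hw : w.im ≠ 0) :
    resolventOp (segalField μ (0 : X → ℂ)) w = (1 / w) • ContinuousLinearMap.id ℂ (Fock μ) := by
  ext1 ψ
  have h := tendsto_resolventOp_segalField (ι := ℕ) (l := atTop) (g := fun _ => (0 : X → ℂ))
    (μ := μ) (fun _ => MemLp.zero) (by simp) hw ψ
  exact tendsto_nhds_unique tendsto_const_nhds h

/-- The resolvent identity gives a local Lipschitz bound, because
$|\operatorname{Im}v|>|\operatorname{Im}w|/2$ for `v` near `w`. -/
theorem continuousOn_resolventOp_segalField {g : X → ℂ} (hg : MemLp g 2 μ) :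
    ContinuousOn (resolventOp (segalField μ g)) {w | w.im ≠ 0} := by
  intro w hw
  refine ContinuousAt.continuousWithinAt ?_
  rw [ContinuousAt, tendsto_iff_norm_sub_tendsto_zero]
  have hw' : 0 < |w.im| := abs_pos.mpr hw
  have hev : ∀ᶠ v : ℂ in 𝓝 w, |w.im| / 2 < |v.im| :=
    (Complex.continuous_im.abs.tendsto w).eventually (lt_mem_nhds (half_lt_self hw'))
  refine squeeze_zero' (g := fun v => ‖w - v‖ * ((|w.im| / 2)⁻¹ * |w.im|⁻¹))
    (.of_forall fun v => norm_nonneg _) ?_ ?_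
  · filter_upwards [hev] with v hv
    have hv0 : v.im ≠ 0 := abs_pos.mp ((half_pos hw').trans hv)
    rw [(isResolvent_segalField hg hv0).sub_eq (isResolvent_segalField hg hw), norm_smul]
    refine mul_le_mul_of_nonneg_left ((norm_mul_le _ _).trans ?_) (norm_nonneg _)
    refine mul_le_mul ((norm_resolventOp_segalField_le hg hv0).trans ?_)
      (norm_resolventOp_segalField_le hg hw) (norm_nonneg _) (by positivity)
    exact inv_anti₀ (half_pos hw') hv.le
  · have : Tendsto (fun v : ℂ => ‖w - v‖) (𝓝 w) (𝓝 0) := by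
      simpa using (continuous_const.sub continuous_id).norm.tendsto w (f := fun v : ℂ => ‖w - v‖)
    simpa using this.mul_const ((|w.im| / 2)⁻¹ * |w.im|⁻¹)

end Segal

/-! ### Test functions -/

section TestFunctions

variable {d : ℕ} {s β ρbar : ℝ} {f : Space d → ℂ}

theorem norm_fourierKernel (k x : Space d) :
    ‖Complex.exp (-Complex.I * ((inner ℝ k x : ℝ) : ℂ))‖ = 1 := by
  rw [neg_mul, mul_comm, ← neg_mul, ← Complex.ofReal_neg, Complex.norm_exp_ofReal_mul_I]

theorem continuous_fourier (hf : Integrable f) : Continuous (fourier f) := by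
  refine continuous_const.mul (continuous_of_dominated (bound := fun x => ‖f x‖) ?_ ?_ hf.norm ?_)
  · exact fun k => (Continuous.aestronglyMeasurable (by fun_prop)).mul hf.1
  · exact fun k => .of_forall fun x => by rw [norm_mul, norm_fourierKernel, one_mul]
  · exact .of_forall fun x => by fun_prop

theorem planck_nonneg (hβ : 0 < β) (k : Space d) : 0 ≤ planck s β k := by
  refine one_div_nonneg.mpr (sub_nonneg.mpr (Real.one_le_exp ?_))
  exact mul_nonneg hβ.le (Real.rpow_nonneg (norm_nonneg k) s)

theorem measurable_planck : Measurable (planck s β : Space d → ℝ) := by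
  unfold planck oneParticleEnergy
  fun_prop

/-- This is $\coth(x/2)=1+2/(e^x-1)$. The origin is excluded: for $s>0$, division by zero makes the
two sides 0 and 1 there. -/
theorem thermalWeight_eq (hβ : 0 < β) {k : Space d} (hk : k ≠ 0) :
    thermalWeight s β k = 1 + 2 * planck s β k := by
  have hx : 0 < β * oneParticleEnergy s k :=
    mul_pos hβ (Real.rpow_pos_of_pos (norm_pos_iff.mpr hk) s)
  rw [thermalWeight, planck]
  set x := β * oneParticleEnergy s k
  have h1 : Real.exp x = Real.exp (x / 2) * Real.exp (x / 2) := by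
    rw [← Real.exp_add, add_halves]
  have h2 : Real.exp (-(x / 2)) = (Real.exp (x / 2))⁻¹ := Real.exp_neg _
  have h3 : 1 < Real.exp (x / 2) := Real.one_lt_exp_iff.mpr (half_pos hx)
  rw [Real.cosh_eq, Real.sinh_eq, h1, h2]
  set y := Real.exp (x / 2)
  have h4 : y * y - 1 ≠ 0 := by nlinarith
  have h5 : y - y⁻¹ ≠ 0 := by
    have : y⁻¹ < 1 := inv_lt_one_of_one_lt₀ h3
    linarith
  have h6 : y ≠ 0 := by linarith
  have h7 : y ^ 2 - 1 ≠ 0 := by rwa [sq]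
  field_simp
  ring

theorem measurable_arakiWoodsVector (hf : Integrable f) :
    Measurable (arakiWoodsVector s β f) := by
  have h1 := (continuous_fourier hf).measurable
  have h2 : Measurable (planck s β : Space d → ℝ) := measurable_planck
  refine Measurable.ite ?_ ?_ ?_
  · exact measurable_fst (measurableSet_singleton 0)
  · fun_prop
  · have : Measurable fun x : Fin 2 × Space d => (starRingEnd ℂ) (fourier f x.2) :=
      Complex.continuous_conj.measurable.comp (h1.comp measurable_snd)
    fun_prop

theorem ae_ne_zero (hd : 1 ≤ d) : ∀ᵐ k : Space d, k ≠ 0 := by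
  have : Nonempty (Fin d) := ⟨⟨0, hd⟩⟩
  have : Nontrivial (Space d) := inferInstance
  exact compl_mem_ae_iff.mpr (measure_singleton (μ := (volume : Measure (Space d))) 0)

/-- The two summands contribute the weights $1+n$ and $n$, whose sum is $\coth(\beta h/2)$ off the
null set $\{0\}$. -/
theorem eLpNorm_arakiWoodsVector_sq (hd : 1 ≤ d) (hβ : 0 < β) (hf : Integrable f) :
    eLpNorm (arakiWoodsVector s β f) 2 (doubledMeasure d) ^ 2 = qNonzero s β f := by
  rw [← lintegral_enorm_sq_eq,
    lintegral_prod _ ((measurable_arakiWoodsVector hf).enorm.pow_const 2).aemeasurable,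
    lintegral_count, tsum_fintype, Fin.sum_univ_two, ← lintegral_add_left, qNonzero]
  · refine lintegral_congr_ae ?_
    filter_upwards [ae_ne_zero hd] with k hk
    have hn := planck_nonneg (s := s) hβ k
    have key : ∀ (a : ℝ) (z : ℂ), 0 ≤ a → ‖z‖ = ‖fourier f k‖ →
        ‖((√a : ℝ) : ℂ) * z‖ₑ ^ 2 = ENNReal.ofReal (a * ‖fourier f k‖ ^ 2) := by
      intro a z ha hz
      rw [← ofReal_norm, ← ENNReal.ofReal_pow (norm_nonneg _), norm_mul, hz, mul_pow,
        Complex.norm_real, Real.norm_eq_abs, sq_abs, Real.sq_sqrt ha]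
    simp only [arakiWoodsVector, if_true, one_ne_zero, if_false]
    rw [key _ _ (by linarith) rfl, key _ _ hn (RCLike.norm_conj _),
      ← ENNReal.ofReal_add (by positivity) (by positivity), thermalWeight_eq hβ hk]
    congr 1
    ring
  · exact ((measurable_arakiWoodsVector hf).comp measurable_prodMk_left).enorm.pow_const 2

theorem memLp_arakiWoodsVector (hd : 1 ≤ d) (hβ : 0 < β) (hf : f ∈ testSpace d s β) :
    MemLp (arakiWoodsVector s β f) 2 (doubledMeasure d) := by
  refine ⟨(measurable_arakiWoodsVector hf.1).aestronglyMeasurable, ?_⟩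
  have h := hf.2.2
  rw [← eLpNorm_arakiWoodsVector_sq hd hβ hf.1] at h
  exact (ENNReal.pow_lt_top_iff.mp h).resolve_right two_ne_zero

end TestFunctions

/-! ### The normalised box indicators and their vanishing thermal norm. -/

section ZeroMode

variable {d : ℕ} {s β ρbar : ℝ}

theorem measurableSet_cube (L : ℝ) : MeasurableSet (cube d L) := by
  have : cube d L = ⋂ i, (fun x : Space d => x i) ⁻¹' Set.Icc (-(L / 2)) (L / 2) := by
    ext x
    simp [cube]
  rw [this]
  exact MeasurableSet.iInter fun i => measurableSet_Icc.preimage (by fun_prop)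

theorem volume_cube (L : ℝ) : volume (cube d L) = ENNReal.ofReal L ^ d := by
  have h := (PiLp.volume_preserving_toLp (Fin d)).measure_preimage
    (measurableSet_cube (d := d) L).nullMeasurableSet
  have hpre : (WithLp.toLp 2 ⁻¹' cube d L : Set (Fin d → ℝ)) =
      Set.pi Set.univ fun _ => Set.Icc (-(L / 2)) (L / 2) := by
    ext x
    simp only [cube, Set.mem_preimage, Set.mem_ofPred_eq, Set.mem_pi, Set.mem_univ, true_imp_iff]
  rw [← h, hpre, volume_pi_pi]
  simp [Real.volume_Icc]

theorem memLp_zeroModeTest (L : ℝ) (p : ℝ≥0∞) : MemLp (zeroModeTest d L) p := by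
  refine memLp_indicator_const p (measurableSet_cube L) _ (Or.inr ?_)
  rw [volume_cube]
  exact (ENNReal.pow_lt_top ENNReal.ofReal_lt_top).ne

theorem integrable_zeroModeTest (L : ℝ) : Integrable (zeroModeTest d L) :=
  memLp_one_iff_integrable.mp (memLp_zeroModeTest L 1)

/-- The Fourier transform of the indicator function of `[-1/2, 1/2]`, up to normalisation. -/
def cardinalSine (t : ℝ) : ℂ :=
  ∫ u, (Set.Icc (-(1 / 2)) (1 / 2)).indicator
    (fun u : ℝ => Complex.exp (-Complex.I * ((t * u : ℝ) : ℂ))) u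

theorem norm_cardinalSine_le_one (t : ℝ) : ‖cardinalSine t‖ ≤ 1 := by
  rw [cardinalSine, integral_indicator measurableSet_Icc]
  refine (norm_setIntegral_le_of_norm_le_const (C := 1) (by simp) fun u _ => ?_).trans ?_
  · rw [neg_mul, mul_comm, ← neg_mul, ← Complex.ofReal_neg, Complex.norm_exp_ofReal_mul_I]
  · norm_num [Measure.real]

theorem cardinalSine_zero : cardinalSine 0 = 1 := by
  rw [cardinalSine, integral_indicator measurableSet_Icc]
  norm_num [Measure.real]

theorem norm_cardinalSine_mul_le {t : ℝ} : ‖cardinalSine t‖ * |t| ≤ 2 := by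
  rcases eq_or_ne t 0 with rfl | ht
  · simp
  have hc : -Complex.I * (t : ℂ) ≠ 0 := by simpa using ht
  have h : cardinalSine t = (Complex.exp (-Complex.I * t * ((1 / 2 : ℝ) : ℂ)) -
      Complex.exp (-Complex.I * t * ((-(1 / 2) : ℝ) : ℂ))) / (-Complex.I * t) := by
    rw [← integral_exp_mul_complex hc, cardinalSine, integral_indicator measurableSet_Icc,
      integral_Icc_eq_integral_Ioc, intervalIntegral.integral_of_le (by norm_num)]
    simp [mul_assoc]
  have hn : ∀ u : ℝ, ‖Complex.exp (-Complex.I * t * (u : ℂ))‖ = 1 := fun u => by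
    rw [show -Complex.I * (t : ℂ) * (u : ℂ) = ((-(t * u) : ℝ) : ℂ) * Complex.I by push_cast; ring,
      Complex.norm_exp_ofReal_mul_I]
  have ht' : |t| ≠ 0 := abs_ne_zero.mpr ht
  rw [h, norm_div, norm_mul, norm_neg, Complex.norm_I, one_mul, Complex.norm_real,
    Real.norm_eq_abs, div_mul_cancel₀ _ ht']
  refine (norm_sub_le _ _).trans ?_
  rw [hn, hn]
  norm_num

/-- Adding $|S|^2\le1$ and $t^2|S|^2\le4$ gives the constant 5 and an integrable majorant. -/
theorem norm_cardinalSine_sq_le (t : ℝ) : ‖cardinalSine t‖ ^ 2 ≤ 5 * (1 + t ^ 2)⁻¹ := by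
  have h1 : ‖cardinalSine t‖ ^ 2 ≤ 1 := pow_le_one₀ (norm_nonneg _) (norm_cardinalSine_le_one t)
  have h2 : ‖cardinalSine t‖ ^ 2 * t ^ 2 ≤ 4 := by
    rw [← sq_abs t, ← mul_pow]
    calc _ ≤ (2 : ℝ) ^ 2 := pow_le_pow_left₀ (by positivity) norm_cardinalSine_mul_le 2
      _ = 4 := by norm_num
  rw [← div_eq_mul_inv, le_div_iff₀ (by positivity)]
  linarith

theorem fourier_zeroModeTest {L : ℝ} (hL : 0 < L) (k : Space d) :
    fourier (zeroModeTest d L) k =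
      (((2 * Real.pi) ^ (-(d : ℝ) / 2) : ℝ) : ℂ) * ∏ i, cardinalSine (L * k i) := by
  rw [fourier]
  congr 1
  -- The substitution $x=Ly$ cancels the prefactor $L^{-d}$ and maps the cube to the unit cube,
  -- where the integrand is a product over coordinates.
  have hsc := Measure.integral_comp_smul (volume : Measure (Space d))
    (fun x => Complex.exp (-Complex.I * ((inner ℝ k x : ℝ) : ℂ)) * zeroModeTest d L x) L
  have hLd : (0 : ℝ) < L ^ d := by positivity
  rw [finrank_euclideanSpace_fin, abs_of_pos (inv_pos.mpr hLd), eq_inv_smul_iff₀ hLd.ne'] at hsc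
  rw [← hsc, ← (PiLp.volume_preserving_toLp (Fin d)).integral_comp
    (MeasurableEquiv.toLp 2 (Fin d → ℝ)).measurableEmbedding]
  simp only [cardinalSine]
  rw [← integral_fintype_prod_volume_eq_prod, ← integral_smul]
  congr 1
  funext x
  have hin : (inner ℝ k (L • WithLp.toLp 2 x) : ℝ) = ∑ i, L * k i * x i := by
    simp [PiLp.inner_apply, mul_comm, mul_left_comm, mul_assoc]
  have hmem : L • WithLp.toLp 2 x ∈ cube d L ↔ ∀ i, x i ∈ Set.Icc (-(1 / 2) : ℝ) (1 / 2) := by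
    refine forall_congr' fun i => ?_
    simp only [PiLp.smul_apply, smul_eq_mul, Set.mem_Icc]
    refine and_congr ⟨fun h => ?_, fun h => ?_⟩ ⟨fun h => ?_, fun h => ?_⟩ <;> nlinarith
  by_cases hx : ∀ i, x i ∈ Set.Icc (-(1 / 2) : ℝ) (1 / 2)
  · rw [zeroModeTest, Set.indicator_of_mem (hmem.mpr hx), hin,
      Finset.prod_congr rfl fun i _ => Set.indicator_of_mem (hx i) _, ← Complex.exp_sum,
      Complex.real_smul, mul_left_comm, mul_inv_cancel₀ (by exact_mod_cast hLd.ne'), mul_one]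
    push_cast
    rw [Finset.mul_sum]
  · rw [zeroModeTest, Set.indicator_of_notMem (mt hmem.mp hx), mul_zero, smul_zero]
    push Not at hx
    obtain ⟨i, hi⟩ := hx
    exact (Finset.prod_eq_zero (Finset.mem_univ i) (Set.indicator_of_notMem hi _)).symm

theorem fourier_zeroModeTest_zero {L : ℝ} (hL : 0 < L) :
    fourier (zeroModeTest d L) 0 = (((2 * Real.pi) ^ (-(d : ℝ) / 2) : ℝ) : ℂ) := by
  simp [fourier_zeroModeTest hL, cardinalSine_zero]

variable (d) in
/-- The square of the normalisation constant of the Fourier transform. -/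
def fourierConstSq : ℝ := ((2 * Real.pi) ^ (-(d : ℝ) / 2)) ^ 2

theorem fourierConstSq_nonneg : 0 ≤ fourierConstSq d := sq_nonneg _

theorem norm_fourier_zeroModeTest_sq {L : ℝ} (hL : 0 < L) (k : Space d) :
    ‖fourier (zeroModeTest d L) k‖ ^ 2 =
      fourierConstSq d * ∏ i, ‖cardinalSine (L * k i)‖ ^ 2 := by
  rw [fourier_zeroModeTest hL, norm_mul, mul_pow, norm_prod, Finset.prod_pow, fourierConstSq,
    Complex.norm_real, Real.norm_eq_abs, sq_abs]

theorem norm_fourier_zeroModeTest_sq_le {L : ℝ} (hL : 0 < L) (k : Space d) :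
    ‖fourier (zeroModeTest d L) k‖ ^ 2 ≤ fourierConstSq d * ∏ i, (5 * (1 + (L * k i) ^ 2)⁻¹) := by
  rw [norm_fourier_zeroModeTest_sq hL]
  exact mul_le_mul_of_nonneg_left (Finset.prod_le_prod (fun _ _ => sq_nonneg _)
    fun i _ => norm_cardinalSine_sq_le _) fourierConstSq_nonneg

theorem norm_fourier_zeroModeTest_sq_le_const {L : ℝ} (hL : 0 < L) (k : Space d) :
    ‖fourier (zeroModeTest d L) k‖ ^ 2 ≤ fourierConstSq d := by
  rw [norm_fourier_zeroModeTest_sq hL]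
  exact mul_le_of_le_one_right fourierConstSq_nonneg (Finset.prod_le_one (fun _ _ => sq_nonneg _)
    fun i _ => pow_le_one₀ (norm_nonneg _) (norm_cardinalSine_le_one _))

theorem tendsto_norm_fourier_zeroModeTest_sq {k : Space d} (hk : k ≠ 0) :
    Tendsto (fun L : ℝ => ‖fourier (zeroModeTest d L) k‖ ^ 2) atTop (𝓝 0) := by
  obtain ⟨i, hi⟩ : ∃ i, k i ≠ 0 := by
    by_contra! h
    exact hk (by ext i; exact h i)
  -- One nonzero coordinate is enough: its factor tends to 0 while every other factor has a finite
  -- limit.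
  have hfac : ∀ j, Tendsto (fun L : ℝ => 5 * (1 + (L * k j) ^ 2)⁻¹) atTop
      (𝓝 (if k j = 0 then 5 else 0)) := by
    intro j
    split_ifs with h
    · simp [h]
    · have h1 : Tendsto (fun L : ℝ => L ^ 2 * k j ^ 2) atTop atTop :=
        (tendsto_pow_atTop two_ne_zero).atTop_mul_const (by positivity)
      have h2 := (tendsto_atTop_add_const_left atTop (1 : ℝ) h1).inv_tendsto_atTop.const_mul 5
      simpa [mul_pow] using h2
  have hprod := (tendsto_finsetProd Finset.univ fun j _ => hfac j).const_mul (fourierConstSq d)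
  rw [Finset.prod_eq_zero (Finset.mem_univ i) (if_neg hi), mul_zero] at hprod
  refine squeeze_zero' (.of_forall fun L => sq_nonneg _) ?_ hprod
  filter_upwards [eventually_gt_atTop 0] with L hL
  exact norm_fourier_zeroModeTest_sq_le hL k

theorem lintegral_prod_inv_one_add_sq_lt_top {L : ℝ} (hL : 0 < L) :
    ∫⁻ k : Space d, ENNReal.ofReal (fourierConstSq d * ∏ i, (5 * (1 + (L * k i) ^ 2)⁻¹)) < ∞ := by
  have h1 : Integrable fun t : ℝ => 5 * (1 + (L * t) ^ 2)⁻¹ :=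
    (integrable_inv_one_add_sq.comp_mul_left' hL.ne').const_mul 5
  have h2 : Integrable fun x : Fin d → ℝ => ∏ i, (5 * (1 + (L * x i) ^ 2)⁻¹) :=
    Integrable.fintype_prod (μ := fun _ => volume) fun _ => h1
  have h3 := ((PiLp.volume_preserving_ofLp (Fin d)).integrable_comp_emb
    (MeasurableEquiv.toLp 2 (Fin d → ℝ)).symm.measurableEmbedding).mpr h2
  exact (h3.const_mul (fourierConstSq d)).lintegral_lt_top

/-- Condensation enters the estimates here, through finiteness of the critical density. -/
theorem lintegral_planck_lt_top (hBEC : criticalDensity d s β < ENNReal.ofReal ρbar) :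
    ∫⁻ k : Space d, ENNReal.ofReal (planck s β k) < ∞ := by
  have h : criticalDensity d s β ≠ ∞ := (hBEC.trans ENNReal.ofReal_lt_top).ne
  refine ENNReal.lt_top_of_mul_ne_top_right h ?_
  rw [Ne, ENNReal.ofReal_eq_zero, not_le]
  positivity

/-- With the weight written as $1+2n$, the part 1 uses the decay of $\hat b_L$, and the part $2n$
only its uniform bound, `n` being integrable itself. -/
theorem thermalWeight_mul_le (hβ : 0 < β) {L : ℝ} (hL : 0 < L) {k : Space d} (hk : k ≠ 0) :
    ENNReal.ofReal (thermalWeight s β k * ‖fourier (zeroModeTest d L) k‖ ^ 2) ≤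
      ENNReal.ofReal (fourierConstSq d * ∏ i, (5 * (1 + (L * k i) ^ 2)⁻¹)) +
        ENNReal.ofReal (2 * fourierConstSq d) * ENNReal.ofReal (planck s β k) := by
  have hn := planck_nonneg (s := s) hβ k
  have hC := fourierConstSq_nonneg (d := d)
  rw [← ENNReal.ofReal_mul (by positivity), ← ENNReal.ofReal_add (by positivity) (by positivity),
    thermalWeight_eq hβ hk, add_mul, one_mul]
  refine ENNReal.ofReal_le_ofReal (add_le_add (norm_fourier_zeroModeTest_sq_le hL k) ?_)
  nlinarith [norm_fourier_zeroModeTest_sq_le_const hL k]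

theorem lintegral_bound_lt_top (hBEC : criticalDensity d s β < ENNReal.ofReal ρbar) {L : ℝ}
    (hL : 0 < L) :
    ∫⁻ k : Space d, (ENNReal.ofReal (fourierConstSq d * ∏ i, (5 * (1 + (L * k i) ^ 2)⁻¹)) +
        ENNReal.ofReal (2 * fourierConstSq d) * ENNReal.ofReal (planck s β k)) < ∞ := by
  rw [lintegral_add_right _ (measurable_planck.ennreal_ofReal.const_mul _),
    lintegral_const_mul _ measurable_planck.ennreal_ofReal]
  exact ENNReal.add_lt_top.mpr ⟨lintegral_prod_inv_one_add_sq_lt_top hL,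
    ENNReal.mul_lt_top ENNReal.ofReal_lt_top (lintegral_planck_lt_top hBEC)⟩

theorem zeroModeTest_mem_testSpace (hd : 1 ≤ d) (hβ : 0 < β)
    (hBEC : criticalDensity d s β < ENNReal.ofReal ρbar) {L : ℝ} (hL : 0 < L) :
    zeroModeTest d L ∈ testSpace d s β := by
  refine ⟨integrable_zeroModeTest L, memLp_zeroModeTest L 2,
    (lintegral_mono_ae ?_).trans_lt (lintegral_bound_lt_top hBEC hL)⟩
  filter_upwards [ae_ne_zero hd] with k hk
  exact thermalWeight_mul_le hβ hL hk

theorem tendsto_qNonzero_zeroModeTest (hd : 1 ≤ d) (hβ : 0 < β)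
    (hBEC : criticalDensity d s β < ENNReal.ofReal ρbar) :
    Tendsto (fun L : ℝ => qNonzero s β (zeroModeTest d L)) atTop (𝓝 0) := by
  rw [← lintegral_zero (μ := (volume : Measure (Space d)))]
  refine tendsto_lintegral_filter_of_dominated_convergence _ (.of_forall fun L => ?_) ?_
    (lintegral_bound_lt_top (L := 1) hBEC one_pos).ne ?_
  · have h1 := (continuous_fourier (integrable_zeroModeTest (d := d) L)).measurable
    have h2 : Measurable (thermalWeight s β : Space d → ℝ) := by
      unfold thermalWeight oneParticleEnergy
      fun_prop
    fun_prop
  -- For $L\ge1$ the majorant decreases in `L`, so its value at $L=1$ dominates the whole family.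
  · filter_upwards [eventually_ge_atTop 1] with L hL
    filter_upwards [ae_ne_zero hd] with k hk
    refine (thermalWeight_mul_le hβ (by linarith) hk).trans (add_le_add_left ?_ _)
    refine ENNReal.ofReal_le_ofReal (mul_le_mul_of_nonneg_left ?_ fourierConstSq_nonneg)
    refine Finset.prod_le_prod (fun i _ => by positivity) fun i _ => ?_
    have h1 : (1 : ℝ) ≤ L ^ 2 := one_le_pow₀ hL
    have h2 : (1 * k i) ^ 2 ≤ (L * k i) ^ 2 := by
      rw [mul_pow, mul_pow, one_pow]
      exact mul_le_mul_of_nonneg_right h1 (sq_nonneg _)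
    gcongr
  · filter_upwards [ae_ne_zero hd] with k hk
    have h := (tendsto_norm_fourier_zeroModeTest_sq hk).const_mul (thermalWeight s β k)
    simpa using ENNReal.tendsto_ofReal h

theorem tendsto_eLpNorm_arakiWoodsVector (hd : 1 ≤ d) (hβ : 0 < β)
    (hBEC : criticalDensity d s β < ENNReal.ofReal ρbar) :
    Tendsto (fun L : ℝ => eLpNorm (arakiWoodsVector s β (zeroModeTest d L)) 2 (doubledMeasure d))
      atTop (𝓝 0) := by
  have h := tendsto_qNonzero_zeroModeTest (s := s) hd hβ hBEC
  have h2 := h.ennrpow_const (1 / 2 : ℝ)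
  rw [ENNReal.zero_rpow_of_pos (by norm_num)] at h2
  refine h2.congr fun L => ?_
  rw [← eLpNorm_arakiWoodsVector_sq hd hβ (integrable_zeroModeTest L), ← ENNReal.rpow_natCast,
    ← ENNReal.rpow_mul]
  norm_num

end ZeroMode

/-! ### Direct integrals -/

section Auxiliary

variable {H : Type*} [NormedAddCommGroup H] [NormedSpace ℂ H]

/-- The space of operators need not be separable; norm continuity on a second countable space still
makes `T` strongly measurable. -/
theorem aestronglyMeasurable_apply {Y : Type*} [TopologicalSpace Y] [SecondCountableTopology Y]
    [MeasurableSpace Y] [OpensMeasurableSpace Y] {ν : Measure Y} {T : Y → (H →L[ℂ] H)}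
    (hT : Continuous T) {u : Y → H} (hu : AEStronglyMeasurable u ν) :
    AEStronglyMeasurable (fun y => T y (u y)) ν :=
  isBoundedBilinearMap_apply.continuous.comp_aestronglyMeasurable
    (hT.aestronglyMeasurable.prodMk hu)

theorem isClosed_setOf_commute (M : H →L[ℂ] H) : IsClosed {A | M * A = A * M} :=
  isClosed_eq (continuous_const.mul continuous_id) (continuous_id.mul continuous_const)

end Auxiliary

section DirectIntegral

variable {d : ℕ} {T T' : ℝ × ℝ → (ArakiWoods d →L[ℂ] ArakiWoods d)}
  {S S' : BECSpace d →L[ℂ] BECSpace d}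

theorem IsDirectIntegral.isDirectIntegral_directIntegral (h : IsDirectIntegral T S) :
    IsDirectIntegral T (directIntegral T) := by
  have hex : ∃ S, IsDirectIntegral T S := ⟨S, h⟩
  rw [directIntegral, dif_pos hex]
  exact hex.choose_spec

/-- A continuous, uniformly bounded family of operators has a direct integral. -/
theorem exists_isDirectIntegral (hT : Continuous T) {C : ℝ} (hC : ∀ p, ‖T p‖ ≤ C) :
    ∃ S, IsDirectIntegral T S := by
  have hmem : ∀ Ψ : BECSpace d, MemLp (fun p => T p (Ψ p)) 2 chi := fun Ψ =>
    (Lp.memLp Ψ).of_le_mul (c := C)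
      (aestronglyMeasurable_apply hT (Lp.aestronglyMeasurable Ψ))
      (.of_forall fun p => (T p).le_of_opNorm_le (hC p) _)
  let S : BECSpace d →ₗ[ℂ] BECSpace d :=
    { toFun := fun Ψ => (hmem Ψ).toLp
      map_add' := fun Φ Ψ => by
        rw [← MemLp.toLp_add]
        refine MemLp.toLp_congr _ _ ?_
        filter_upwards [Lp.coeFn_add Φ Ψ] with p hp
        simp only [hp, Pi.add_apply, map_add]
      map_smul' := fun z Ψ => by
        rw [RingHom.id_apply, ← MemLp.toLp_const_smul]
        refine MemLp.toLp_congr _ _ ?_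
        filter_upwards [Lp.coeFn_smul z Ψ] with p hp
        simp only [hp, Pi.smul_apply, map_smul] }
  refine ⟨S.mkContinuous C fun Ψ => ?_, fun Ψ => (hmem Ψ).coeFn_toLp⟩
  refine Lp.norm_le_mul_norm_of_ae_le_mul ?_
  filter_upwards [(hmem Ψ).coeFn_toLp] with p hp
  change ‖(hmem Ψ).toLp _ p‖ ≤ _
  rw [hp]
  exact (T p).le_of_opNorm_le (hC p) _

/-- Fibrewise strong convergence of uniformly bounded families implies strong convergence of the
direct integrals. -/
theorem tendsto_directIntegral {ι : Type*} {l : Filter ι} [l.IsCountablyGenerated]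
    {T : ι → ℝ × ℝ → (ArakiWoods d →L[ℂ] ArakiWoods d)} {S : ι → BECSpace d →L[ℂ] BECSpace d}
    (hS : ∀ᶠ i in l, IsDirectIntegral (T i) (S i)) (hS' : IsDirectIntegral T' S') {C : ℝ}
    (hC : ∀ᶠ i in l, ∀ p, ‖T i p‖ ≤ C) (hC' : ∀ p, ‖T' p‖ ≤ C)
    (hT : ∀ p ψ, Tendsto (fun i => T i p ψ) l (𝓝 (T' p ψ))) (Ψ : BECSpace d) :
    Tendsto (fun i => S i Ψ) l (𝓝 (S' Ψ)) := by
  rw [Lp.tendsto_Lp_iff_tendsto_eLpNorm']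
  have hC0 : 0 ≤ C := (ContinuousLinearMap.opNorm_nonneg _).trans (hC' 0)
  have hlim : Tendsto (fun i => ∫⁻ p, ‖S i Ψ p - S' Ψ p‖ₑ ^ (2 : ℝ) ∂chi) l (𝓝 0) := by
    rw [← lintegral_zero (μ := chi)]
    have hev : ∀ᶠ i in l, ∀ᵐ p ∂chi,
        ‖S i Ψ p - S' Ψ p‖ₑ ^ (2 : ℝ) = ‖T i p (Ψ p) - T' p (Ψ p)‖ₑ ^ (2 : ℝ) := by
      filter_upwards [hS] with i hi
      filter_upwards [hi Ψ, hS' Ψ] with p h1 h2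
      rw [h1, h2]
    have hmain : Tendsto (fun i => ∫⁻ p, ‖T i p (Ψ p) - T' p (Ψ p)‖ₑ ^ (2 : ℝ) ∂chi) l
        (𝓝 (∫⁻ _, 0 ∂chi)) := by
      refine tendsto_lintegral_filter_of_dominated_convergence'
        (fun p => (ENNReal.ofReal (2 * C) * ‖Ψ p‖ₑ) ^ (2 : ℝ)) ?_ ?_ ?_ ?_
      -- No measurability of the operator families is assumed; it is inherited from the $L^2$
      -- functions that represent the direct integrals.
      · filter_upwards [hS] with i hi
        refine (AEMeasurable.congr (f := fun p => ‖S i Ψ p - S' Ψ p‖ₑ ^ (2 : ℝ)) ?_ ?_)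
        · exact ((Lp.aestronglyMeasurable _).sub (Lp.aestronglyMeasurable _)).enorm.pow_const _
        · filter_upwards [hi Ψ, hS' Ψ] with p h1 h2
          rw [h1, h2]
      · filter_upwards [hC] with i hi
        refine .of_forall fun p => ENNReal.rpow_le_rpow ?_ (by norm_num)
        rw [← ofReal_norm, ← ofReal_norm, ← ENNReal.ofReal_mul (by positivity)]
        refine ENNReal.ofReal_le_ofReal ((norm_sub_le _ _).trans ?_)
        have h1 := (T i p).le_of_opNorm_le (hi p) (Ψ p)
        have h2 := (T' p).le_of_opNorm_le (hC' p) (Ψ p)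
        linarith
      · simp_rw [ENNReal.mul_rpow_of_nonneg _ _ (show (0 : ℝ) ≤ 2 by norm_num)]
        have hC2 : ENNReal.ofReal (2 * C) ^ (2 : ℝ) ≠ ∞ :=
          ENNReal.rpow_ne_top_of_nonneg (by norm_num) ENNReal.ofReal_ne_top
        rw [lintegral_const_mul' _ _ hC2]
        refine ENNReal.mul_ne_top hC2 ?_
        have := (Lp.memLp Ψ).2
        rw [eLpNorm_lt_top_iff_lintegral_rpow_enorm_lt_top (by norm_num) (by norm_num)] at this
        simpa using this.ne
      · refine .of_forall fun p => ?_
        have h1 : Tendsto (fun i => ‖T i p (Ψ p) - T' p (Ψ p)‖ₑ) l (𝓝 0) := by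
          have := ((hT p (Ψ p)).sub_const (T' p (Ψ p))).enorm
          simpa using this
        have h2 := h1.ennrpow_const 2
        rwa [ENNReal.zero_rpow_of_pos (by norm_num)] at h2
    exact hmain.congr' (hev.mono fun i hi => (lintegral_congr_ae hi).symm)
  have h2 := hlim.ennrpow_const (1 / 2 : ℝ)
  rw [ENNReal.zero_rpow_of_pos (by norm_num)] at h2
  refine h2.congr fun i => ?_
  rw [eLpNorm_eq_lintegral_rpow_enorm_toReal (by norm_num) (by norm_num)]
  simp

/-- Direct integrals commute with diagonal operators. -/
theorem IsDirectIntegral.commute_of_smul {F : ℝ × ℝ → ℂ}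
    (hS' : IsDirectIntegral (fun p => F p • ContinuousLinearMap.id ℂ (ArakiWoods d)) S')
    (hS : IsDirectIntegral T S) : S' * S = S * S' := by
  ext1 Ψ
  refine Lp.ext ?_
  change S' (S Ψ) =ᵐ[chi] S (S' Ψ)
  filter_upwards [hS' (S Ψ), hS Ψ, hS (S' Ψ), hS' Ψ] with p h1 h2 h3 h4
  rw [h1, h2, h3, h4]
  simp

end DirectIntegral

/-! ### The commutant of the BEC representation -/

section Commutant

variable {d : ℕ} {s β ρbar : ℝ}

theorem mem_becCStarAlgebra_of_generator {lam : ℝ} (hlam : lam ≠ 0) {f : Space d → ℂ}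
    (hf : f ∈ testSpace d s β) : becRep s β ρbar lam f ∈ becCStarAlgebra d s β ρbar :=
  subset_closure (Algebra.subset_adjoin ⟨lam, hlam, f, hf, rfl⟩)

/-- Commuting with a fixed bounded operator survives algebraic operations, norm limits and pointwise
limits, so checking generators is enough. -/
theorem commute_becVonNeumann {M : BECSpace d →L[ℂ] BECSpace d}
    (hM : ∀ lam : ℝ, lam ≠ 0 → ∀ f ∈ testSpace d s β,
      M * becRep s β ρbar lam f = becRep s β ρbar lam f * M) :
    ∀ S ∈ becVonNeumann d s β ρbar, M * S = S * M := by
  have h1 : ∀ A ∈ Algebra.adjoin ℂ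
      {T | ∃ lam : ℝ, lam ≠ 0 ∧ ∃ f ∈ testSpace d s β, T = becRep s β ρbar lam f},
      Commute M A := by
    intro A hA
    induction hA using Algebra.adjoin_induction with
    | mem x hx =>
      obtain ⟨lam, hlam, f, hf, rfl⟩ := hx
      exact hM lam hlam f hf
    | algebraMap r => exact (Algebra.commutes r M).symm
    | add x y _ _ hx hy => exact hx.add_right hy
    | mul x y _ _ hx hy => exact hx.mul_right hy
  have h2 : ∀ A ∈ becCStarAlgebra d s β ρbar, M * A = A * M := fun A hA =>
    closure_minimal (t := {A | M * A = A * M}) h1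
      (isClosed_setOf_commute M) hA
  intro S hS
  -- In the product topology evaluations are continuous, so only the continuity of `M` is used and
  -- `S` ranges over arbitrary maps.
  have hcl : IsClosed {S : BECSpace d → BECSpace d | ∀ Ψ, M (S Ψ) = S (M Ψ)} := by
    have : {S : BECSpace d → BECSpace d | ∀ Ψ, M (S Ψ) = S (M Ψ)} =
        ⋂ Ψ, {S | M (S Ψ) = S (M Ψ)} := by
      ext S
      simp
    rw [this]
    exact isClosed_iInter fun Ψ =>
      isClosed_eq (M.continuous.comp (continuous_apply Ψ)) (continuous_apply (M Ψ))
  have h3 := closure_minimal (t := {S : BECSpace d → BECSpace d | ∀ Ψ, M (S Ψ) = S (M Ψ)})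
    (by
      rintro _ ⟨A, hA, rfl⟩ Ψ
      exact congrArg (fun B : BECSpace d →L[ℂ] BECSpace d => B Ψ) (h2 A hA)) hcl hS
  ext1 Ψ
  exact h3 Ψ

end Commutant

/-! ### The order parameter -/

section OrderParameter

variable {d : ℕ} {s β ρbar : ℝ}

theorem re_fibrePoint (p : ℝ × ℝ) : (fibrePoint d s β ρbar p).re = 1 := by
  simp [fibrePoint]

/-- The denominator never vanishes because $\operatorname{Re}z(r,\theta)=1$. -/
theorem continuous_orderFunction : Continuous (orderFunction d s β ρbar) := by
  have h : Continuous (fibrePoint d s β ρbar) := by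
    unfold fibrePoint
    fun_prop
  refine continuous_const.div (continuous_const.mul h) fun p => ?_
  refine mul_ne_zero Complex.I_ne_zero fun h0 => ?_
  have := re_fibrePoint (d := d) (s := s) (β := β) (ρbar := ρbar) p
  rw [h0] at this
  simp at this

theorem norm_orderFunction_le_one (p : ℝ × ℝ) : ‖orderFunction d s β ρbar p‖ ≤ 1 := by
  rw [orderFunction, norm_div, norm_mul, Complex.norm_I, norm_one, one_mul]
  refine div_le_one_of_le₀ ?_ (norm_nonneg _)
  have h := Complex.abs_re_le_norm (fibrePoint d s β ρbar p)
  rwa [re_fibrePoint, abs_one] at h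

theorem condensateConst_nonneg (hBEC : criticalDensity d s β < ENNReal.ofReal ρbar) :
    0 ≤ condensateConst d s β ρbar := by
  have h : (criticalDensity d s β).toReal < ρbar := ENNReal.toReal_lt_of_lt_ofReal hBEC
  have h' : 0 ≤ condensateDensity d s β ρbar := by
    rw [condensateDensity]
    linarith
  rw [condensateConst]
  positivity

/-- $\hat b_L(0)$ is real and independent of `L`; nonnegativity of `c` splits $\sqrt{cr}$ for every
real `r`. -/
theorem classicalField_zeroModeTest (hBEC : criticalDensity d s β < ENNReal.ofReal ρbar) {L : ℝ}
    (hL : 0 < L) (p : ℝ × ℝ) :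
    classicalField s β ρbar p (zeroModeTest d L) =
      orderConst d s β ρbar * √p.1 * Real.cos p.2 := by
  rw [classicalField, fourier_zeroModeTest_zero hL, Complex.re_mul_ofReal, mul_comm Complex.I,
    Complex.exp_ofReal_mul_I_re, Real.sqrt_mul (condensateConst_nonneg hBEC), orderConst]
  ring

theorem fibreRep_zeroModeTest (hBEC : criticalDensity d s β < ENNReal.ofReal ρbar) {L : ℝ}
    (hL : 0 < L) (p : ℝ × ℝ) :
    fibreRep s β ρbar 1 (zeroModeTest d L) p =
      arakiWoodsResolvent s β (fibrePoint d s β ρbar p) (zeroModeTest d L) := by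
  rw [fibreRep, classicalField_zeroModeTest hBEC hL, fibrePoint, Complex.ofReal_one]

theorem im_I_mul (z : ℂ) : (Complex.I * z).im = z.re := by simp

theorem isResolvent_arakiWoodsResolvent (hd : 1 ≤ d) (hβ : 0 < β) {f : Space d → ℂ}
    (hf : f ∈ testSpace d s β) {z : ℂ} (hz : z.re ≠ 0) :
    IsResolvent (arakiWoodsField s β f) (Complex.I * z) (arakiWoodsResolvent s β z f) :=
  isResolvent_segalField (memLp_arakiWoodsVector hd hβ hf) (by rwa [im_I_mul])

theorem norm_arakiWoodsResolvent_le (hd : 1 ≤ d) (hβ : 0 < β) {f : Space d → ℂ}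
    (hf : f ∈ testSpace d s β) {z : ℂ} (hz : z.re ≠ 0) :
    ‖arakiWoodsResolvent s β z f‖ ≤ |z.re|⁻¹ := by
  rw [← im_I_mul]
  exact norm_resolventOp_segalField_le (memLp_arakiWoodsVector hd hβ hf) (by rwa [im_I_mul])

theorem re_fibreRep_point (lam ℓ : ℝ) : ((lam : ℂ) - Complex.I * (ℓ : ℂ)).re = lam := by simp

theorem norm_fibreRep_le (hd : 1 ≤ d) (hβ : 0 < β) {f : Space d → ℂ}
    (hf : f ∈ testSpace d s β) {lam : ℝ} (hlam : lam ≠ 0) (p : ℝ × ℝ) :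
    ‖fibreRep s β ρbar lam f p‖ ≤ |lam|⁻¹ := by
  have h := norm_arakiWoodsResolvent_le hd hβ hf
    (z := (lam : ℂ) - Complex.I * (classicalField s β ρbar p f : ℂ))
    (by rwa [re_fibreRep_point])
  rwa [re_fibreRep_point] at h

theorem continuous_fibreRep (hd : 1 ≤ d) (hβ : 0 < β) {f : Space d → ℂ}
    (hf : f ∈ testSpace d s β) {lam : ℝ} (hlam : lam ≠ 0) :
    Continuous (fibreRep s β ρbar lam f) := by
  refine (continuousOn_resolventOp_segalField (memLp_arakiWoodsVector hd hβ hf)).comp_continuous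
    (f := fun p => Complex.I * ((lam : ℂ) - Complex.I * (classicalField s β ρbar p f : ℂ))) ?_ ?_
  · unfold classicalField
    fun_prop
  · intro p
    change (Complex.I * _).im ≠ 0
    rwa [im_I_mul, re_fibreRep_point]

theorem isDirectIntegral_becRep (hd : 1 ≤ d) (hβ : 0 < β) {f : Space d → ℂ}
    (hf : f ∈ testSpace d s β) {lam : ℝ} (hlam : lam ≠ 0) :
    IsDirectIntegral (fibreRep s β ρbar lam f) (becRep s β ρbar lam f) := by
  obtain ⟨S, hS⟩ := exists_isDirectIntegral (continuous_fibreRep (ρbar := ρbar) hd hβ hf hlam)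
    (norm_fibreRep_le hd hβ hf hlam)
  exact hS.isDirectIntegral_directIntegral

theorem arakiWoodsResolvent_zero (p : ℝ × ℝ) :
    arakiWoodsResolvent s β (fibrePoint d s β ρbar p) (0 : Space d → ℂ) =
      orderFunction d s β ρbar p • ContinuousLinearMap.id ℂ (ArakiWoods d) := by
  have h : arakiWoodsVector s β (0 : Space d → ℂ) = 0 := by
    funext x
    simp [arakiWoodsVector, fourier]
  rw [arakiWoodsResolvent, arakiWoodsField, h, resolventOp_segalField_zero, orderFunction]
  rw [im_I_mul, re_fibrePoint]
  exact one_ne_zero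

theorem tendsto_arakiWoodsResolvent_zeroModeTest (hd : 1 ≤ d) (hβ : 0 < β)
    (hBEC : criticalDensity d s β < ENNReal.ofReal ρbar) (p : ℝ × ℝ) (ψ : ArakiWoods d) :
    Tendsto (fun L : ℝ => arakiWoodsResolvent s β (fibrePoint d s β ρbar p) (zeroModeTest d L) ψ)
      atTop (𝓝 (orderFunction d s β ρbar p • ψ)) := by
  have hw : (Complex.I * fibrePoint d s β ρbar p).im ≠ 0 := by
    rw [im_I_mul, re_fibrePoint]
    exact one_ne_zero
  -- The general convergence theorem wants square integrable vectors at every index, so `L` is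
  -- replaced by `max L 1`, which changes nothing eventually.
  have hpos : ∀ L : ℝ, 0 < max L 1 := fun L => lt_max_of_lt_right one_pos
  have hev : (fun L : ℝ => max L 1) =ᶠ[atTop] id := by
    filter_upwards [eventually_ge_atTop 1] with L hL
    exact max_eq_left hL
  have h := tendsto_resolventOp_segalField (l := atTop)
    (g := fun L : ℝ => arakiWoodsVector s β (zeroModeTest d (max L 1)))
    (fun L => memLp_arakiWoodsVector hd hβ (zeroModeTest_mem_testSpace hd hβ hBEC (hpos L)))
    ((tendsto_eLpNorm_arakiWoodsVector hd hβ hBEC).congr' (hev.mono fun L hL => by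
      simp only [hL, id])) hw ψ
  refine h.congr' (hev.mono fun L hL => ?_)
  simp only [hL, id]
  rfl

end OrderParameter

end BoseGas

end

theorem mainTheorem4 (d : ℕ) (hd : 1 ≤ d) (s β ρbar : ℝ) (hs : 0 < s) (hβ : 0 < β)
    (hBEC : BoseGas.criticalDensity d s β < ENNReal.ofReal ρbar) :
    -- the Araki–Woods resolvents exist, and so do their direct integrals `π_BEC(R(lam, f))`
    (∀ f ∈ BoseGas.testSpace d s β,
      (∀ z : ℂ, z.re ≠ 0 →
        BoseGas.IsResolvent (BoseGas.arakiWoodsField s β f) (Complex.I * z)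
          (BoseGas.arakiWoodsResolvent s β z f)) ∧
      ∀ lam : ℝ, lam ≠ 0 →
        BoseGas.IsDirectIntegral (BoseGas.fibreRep s β ρbar lam f)
          (BoseGas.becRep s β ρbar lam f)) ∧
    -- `b_L^{(1)}` is a test function, with `ℓ_{β,r,θ}(b_L^{(1)}) = a √r cos θ`, so that
    -- `π_{r,θ}(R(1, b_L^{(1)})) = R_{β,l}(z(r,θ), b_L^{(1)})`
    (∀ L : ℝ, 0 < L → BoseGas.zeroModeTest d L ∈ BoseGas.testSpace d s β ∧
      ∀ p : ℝ × ℝ,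
        BoseGas.classicalField s β ρbar p (BoseGas.zeroModeTest d L) =
          BoseGas.orderConst d s β ρbar * Real.sqrt p.1 * Real.cos p.2 ∧
        BoseGas.fibreRep s β ρbar 1 (BoseGas.zeroModeTest d L) p =
          BoseGas.arakiWoodsResolvent s β (BoseGas.fibrePoint d s β ρbar p)
            (BoseGas.zeroModeTest d L)) ∧
    -- on each fibre the resolvents converge strongly to `R_{β,l}(z(r,θ), 0) = F(r,θ)`
    (∀ p : ℝ × ℝ,
      (∀ ψ : BoseGas.ArakiWoods d,
        Filter.Tendsto
          (fun L : ℝ => BoseGas.arakiWoodsResolvent s β (BoseGas.fibrePoint d s β ρbar p)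
            (BoseGas.zeroModeTest d L) ψ)
          Filter.atTop
          (nhds (BoseGas.arakiWoodsResolvent s β (BoseGas.fibrePoint d s β ρbar p) 0 ψ))) ∧
      BoseGas.arakiWoodsResolvent s β (BoseGas.fibrePoint d s β ρbar p)
          (0 : BoseGas.Space d → ℂ) =
        BoseGas.orderFunction d s β ρbar p • ContinuousLinearMap.id ℂ (BoseGas.ArakiWoods d)) ∧
    -- `F` is a bounded continuous function
    (Continuous (BoseGas.orderFunction d s β ρbar) ∧
      ∀ p : ℝ × ℝ, ‖BoseGas.orderFunction d s β ρbar p‖ ≤ 1) ∧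
    -- `π_BEC(R(1, b_L^{(1)}))` converges strongly to the multiplication by `F`, which is an
    -- element of the center of the von Neumann algebra
    ∃ MF : BoseGas.BECSpace d →L[ℂ] BoseGas.BECSpace d,
      (∀ Ψ : BoseGas.BECSpace d,
        MF Ψ =ᵐ[BoseGas.chi] fun p => BoseGas.orderFunction d s β ρbar p • Ψ p) ∧
      (∀ Ψ : BoseGas.BECSpace d,
        Filter.Tendsto
          (fun L : ℝ => BoseGas.becRep s β ρbar 1 (BoseGas.zeroModeTest d L) Ψ)
          Filter.atTop (nhds (MF Ψ))) ∧
      MF ∈ BoseGas.becCenter d s β ρbar := by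
  have hlimit := BoseGas.tendsto_arakiWoodsResolvent_zeroModeTest hd hβ hBEC
  have hmem : ∀ L : ℝ, 0 < L → BoseGas.zeroModeTest d L ∈ BoseGas.testSpace d s β :=
    fun L hL => BoseGas.zeroModeTest_mem_testSpace hd hβ hBEC hL
  refine ⟨fun f hf => ⟨fun z hz => BoseGas.isResolvent_arakiWoodsResolvent hd hβ hf hz,
      fun lam hlam => BoseGas.isDirectIntegral_becRep hd hβ hf hlam⟩,
    fun L hL => ⟨hmem L hL, fun p => ⟨BoseGas.classicalField_zeroModeTest hBEC hL p,
      BoseGas.fibreRep_zeroModeTest hBEC hL p⟩⟩,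
    fun p => ⟨fun ψ => ?_, BoseGas.arakiWoodsResolvent_zero p⟩,
    ⟨BoseGas.continuous_orderFunction, BoseGas.norm_orderFunction_le_one⟩, ?_⟩
  · rw [BoseGas.arakiWoodsResolvent_zero]
    exact hlimit p ψ
  have hnorm : ∀ p, ‖BoseGas.orderFunction d s β ρbar p •
      ContinuousLinearMap.id ℂ (BoseGas.ArakiWoods d)‖ ≤ 1 := fun p => by
    refine ContinuousLinearMap.opNorm_le_bound _ zero_le_one fun ψ => ?_
    change ‖BoseGas.orderFunction d s β ρbar p • ψ‖ ≤ 1 * ‖ψ‖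
    rw [norm_smul]
    exact mul_le_mul_of_nonneg_right (BoseGas.norm_orderFunction_le_one p) (norm_nonneg ψ)
  obtain ⟨MF, hMF⟩ := BoseGas.exists_isDirectIntegral
    (T := fun p => BoseGas.orderFunction d s β ρbar p •
      ContinuousLinearMap.id ℂ (BoseGas.ArakiWoods d))
    (BoseGas.continuous_orderFunction.smul continuous_const) hnorm
  have hconv : ∀ Ψ, Filter.Tendsto
      (fun L : ℝ => BoseGas.becRep s β ρbar 1 (BoseGas.zeroModeTest d L) Ψ)
      Filter.atTop (nhds (MF Ψ)) := by
    refine BoseGas.tendsto_directIntegral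
      (T := fun L => BoseGas.fibreRep s β ρbar 1 (BoseGas.zeroModeTest d L)) ?_ hMF (C := 1) ?_
      hnorm fun p ψ => ?_
    · filter_upwards [Filter.eventually_gt_atTop 0] with L hL
      exact BoseGas.isDirectIntegral_becRep hd hβ (hmem L hL) one_ne_zero
    · filter_upwards [Filter.eventually_gt_atTop 0] with L hL p
      simpa using BoseGas.norm_fibreRep_le (ρbar := ρbar) hd hβ (hmem L hL) one_ne_zero p
    · refine (hlimit p ψ).congr' ?_
      filter_upwards [Filter.eventually_gt_atTop 0] with L hL
      rw [BoseGas.fibreRep_zeroModeTest hBEC hL]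
  refine ⟨MF, hMF, hconv, ?_, ?_⟩
  -- Strong convergence is convergence in the product topology that defines the von Neumann closure,
  -- so the limit of elements of the algebra belongs to it.
  · refine mem_closure_of_tendsto (tendsto_pi_nhds.mpr hconv) ?_
    filter_upwards [Filter.eventually_gt_atTop 0] with L hL
    exact ⟨_, BoseGas.mem_becCStarAlgebra_of_generator one_ne_zero (hmem L hL), rfl⟩
  · exact BoseGas.commute_becVonNeumann fun lam hlam f hf =>
      hMF.commute_of_smul (BoseGas.isDirectIntegral_becRep hd hβ hf hlam)
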